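/- Let $d\ge 3$, let $S^{d-1}\subset\mathbb{R}^d$ be the Euclidean unit sphere with volume (surface) measure $\sigma_{d-1}$, and write $\omega_{d-2}$ for the total volume of the unit sphere $S^{d-2}$ of $\mathbb{R}^{d-1}$. Let $p:S^{d-1}\to(0,\infty)$ be lower semi-continuous with $Z:=\int_{S^{d-1}}p\,d\sigma_{d-1}\in(0,\infty)$, and let $\pi(dx)=\frac1Z\,p(x)\,\sigma_{d-1}(dx)$. For $x\in S^{d-1}$ let $S_x^{d-2}=\{v\in S^{d-1}:\langle v,x\rangle=0\}$ be the unit sphere of the tangent space at $x$, with its natural volume measure $\mu_x$, and for $v\in S_x^{d-2}$ put $\gamma_{(x,v)}(\theta)=\cos(\theta)x+\sin(\theta)v$. For $t\in(0,p(x))$ let $Q_{x,v,t}$ be the distribution on $[0,2\pi)$ of $\theta \bmod 2\pi$, where $\theta$ is the output of the following shrinkage procedure: draw $\theta$ uniformly from $(0,2\pi)$ and set $\theta_{\min}=\theta-2\pi$, $\theta_{\max}=\theta$; as long as $p(\gamma_{(x,v)}(\theta))\le t$, replace $\theta_{\min}$ by $\theta$ if $\theta<0$ and $\theta_{\max}$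 by $\theta$ otherwise, and then draw a new $\theta$ uniformly from $(\theta_{\min},\theta_{\max})$ (all draws being independent given the interval); when $p(\gamma_{(x,v)}(\theta))>t$, return $\theta$. For $x\in S^{d-1}$ and Borel sets $A\subseteq S^{d-1}$ define $$\widetilde H_t(x,A)=\frac1{\omega_{d-2}}\int_{S_x^{d-2}}\int_{[0,2\pi)}\mathbf 1_A\big(\gamma_{(x,v)}(\theta)\big)\,Q_{x,v,t}(d\theta)\,\mu_x(dv),\quad t\in(0,p(x)),\qquad \widetilde H(x,A)=\frac1{p(x)}\int_0^{p(x)}\widetilde H_t(x,A)\,dt .$$ Then $\widetilde H$ (the geodesic shrinkage slice sampling kernel) is a Markov kernel on $S^{d-1}$, and it is reversible with respect to $\pi$: for all Borel sets $A,B\subseteq S^{d-1}$, $$\int_B\widetilde H(x,A)\,\pi(dx)=\int_A\widetilde H(x,B)\,\pi(dx).$$ -/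

import Mathlib

open MeasureTheory ProbabilityTheory Set
open scoped ENNReal

noncomputable section

namespace GeoSlice

/-- The Euclidean space `ℝ^d`. -/
abbrev E (d : ℕ) : Type := EuclideanSpace ℝ (Fin d)

/-- The unit sphere `S^{d-1}` in `ℝ^d`. -/
abbrev Sphere (d : ℕ) : Type := Metric.sphere (0 : E d) 1

/-- The volume (surface) measure `σ_{d-1}` of the unit sphere of `ℝ^d`. -/
def sphereMeasure (d : ℕ) : Measure (Sphere d) :=
  (volume : Measure (E d)).toSphere

/-- The total volume of the unit sphere of `ℝ^d`, i.e. `ω_{d-1} = σ_{d-1}(S^{d-1})`. -/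
def sphereArea (d : ℕ) : ℝ≥0∞ := sphereMeasure d univ

/-- The tangent space `E_x = {y | ⟪y, x⟫ = 0}` of the sphere at `x`, a Euclidean space with the
inner product of `ℝ^d`. -/
abbrev TangentSpaceAt {d : ℕ} (x : Sphere d) : Submodule ℝ (E d) := (ℝ ∙ (x : E d))ᗮ

/-- The great subsphere with pole `x`, i.e. the set of the unit vectors `v` with `⟪v, x⟫ = 0`,
as the unit sphere of the tangent space at `x`. -/
abbrev TangentSphere {d : ℕ} (x : Sphere d) : Type := Metric.sphere (0 : TangentSpaceAt x) 1

/-- The natural volume measure `μ_x` of the great subsphere with pole `x`. -/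
def tangentMeasure {d : ℕ} (x : Sphere d) : Measure (TangentSphere x) :=
  (volume : Measure (TangentSpaceAt x)).toSphere

theorem geodesic_mem {d : ℕ} (x : Sphere d) (v : TangentSphere x) (θ : ℝ) :
    Real.cos θ • (x : E d) + Real.sin θ • ((v : TangentSpaceAt x) : E d)
      ∈ Metric.sphere (0 : E d) 1 := by
  have hx : ‖(x : E d)‖ = 1 := by simp
  have hv : ‖((v : TangentSpaceAt x) : E d)‖ = 1 :=
    norm_eq_of_mem_sphere v
  have hxv : inner ℝ (x : E d) ((v : TangentSpaceAt x) : E d) = 0 :=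
    Submodule.mem_orthogonal_singleton_iff_inner_right.1 (v : TangentSpaceAt x).2
  have h0 : inner ℝ (Real.cos θ • (x : E d))
      (Real.sin θ • ((v : TangentSpaceAt x) : E d)) = 0 := by
    simp [inner_smul_left, inner_smul_right, hxv]
  have h := norm_add_sq_eq_norm_sq_add_norm_sq_of_inner_eq_zero _ _ h0
  rw [norm_smul, norm_smul, hx, hv, mul_one, mul_one, Real.norm_eq_abs, Real.norm_eq_abs,
    abs_mul_abs_self, abs_mul_abs_self] at h
  have h1 := Real.cos_sq_add_sin_sq θ
  rw [mem_sphere_zero_iff_norm]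
  nlinarith [norm_nonneg (Real.cos θ • (x : E d) +
    Real.sin θ • ((v : TangentSpaceAt x) : E d))]

/-- The great circle `γ_{(x,v)}(θ) = cos(θ) x + sin(θ) v`. -/
def geodesic {d : ℕ} (x : Sphere d) (v : TangentSphere x) (θ : ℝ) : Sphere d :=
  ⟨Real.cos θ • (x : E d) + Real.sin θ • ((v : TangentSpaceAt x) : E d), geodesic_mem x v θ⟩

/-! The shrinkage procedure, driven by independent uniform random numbers `u 0, u 1, …` in
`[0, 1]`: a draw from the uniform distribution on `(a, b)` is `a + u * (b - a)`. -/

/-- The variables `θ_min`, `θ_max`, `θ` of the shrinkage procedure. -/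
structure ShrinkState where
  θmin : ℝ
  θmax : ℝ
  θ : ℝ

/-- Initialisation: `θ` is uniform on `(0, 2π)`, `θ_min = θ - 2π` and `θ_max = θ`. -/
def shrinkInit (u : unitInterval) : ShrinkState where
  θmin := 2 * Real.pi * u - 2 * Real.pi
  θmax := 2 * Real.pi * u
  θ := 2 * Real.pi * u

/-- Body of the loop: the current `θ` replaces `θ_min` if it is negative and `θ_max` otherwise,
then the new `θ` is drawn uniformly from `(θ_min, θ_max)`. -/
def shrinkStep (s : ShrinkState) (u : unitInterval) : ShrinkState :=
  let a := if s.θ < 0 then s.θ else s.θmin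
  let b := if s.θ < 0 then s.θmax else s.θ
  { θmin := a, θmax := b, θ := a + u * (b - a) }

/-- The variables after the loop body has been run `n` times. -/
def shrinkState (u : ℕ → unitInterval) : ℕ → ShrinkState
  | 0 => shrinkInit (u 0)
  | n + 1 => shrinkStep (shrinkState u n) (u (n + 1))

/-- The numbers `n` for which the loop condition `p(cos(θ) x + sin(θ) v) ≤ t` fails after `n` runs
of the body. The loop is left at the smallest of them. -/
def shrinkAccepts {d : ℕ} (p : Sphere d → ℝ) (x : Sphere d) (v : TangentSphere x) (t : ℝ)
    (u : ℕ → unitInterval) : Set ℕ :=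
  {n | t < p (geodesic x v (shrinkState u n).θ)}

/-- The output of the shrinkage procedure (meaningful if the loop terminates). -/
def shrinkOutput {d : ℕ} (p : Sphere d → ℝ) (x : Sphere d) (v : TangentSphere x) (t : ℝ)
    (u : ℕ → unitInterval) : ℝ :=
  (shrinkState u (sInf (shrinkAccepts p x v t u))).θ

/-- The law of a sequence of independent random variables that are uniform on `[0, 1]`. -/
def uniformSeq : Measure (ℕ → unitInterval) :=
  Measure.infinitePi fun _ : ℕ => (volume : Measure unitInterval)

/-- The shrinkage distribution `Q_{x,v,t}` on `[0, 2π)`: the law of the output of the procedure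
modulo `2π`. Runs of the loop that do not terminate have no output and contribute no mass. -/
def shrinkageDist {d : ℕ} (p : Sphere d → ℝ) (x : Sphere d) (v : TangentSphere x) (t : ℝ) :
    Measure ℝ :=
  (uniformSeq.restrict {u | (shrinkAccepts p x v t u).Nonempty}).map
    fun u => toIcoMod Real.two_pi_pos 0 (shrinkOutput p x v t u)

/-- The level set kernel `H̃_t(x, A)`. -/
def levelKernel {d : ℕ} (p : Sphere d → ℝ) (t : ℝ) (x : Sphere d) (A : Set (Sphere d)) : ℝ≥0∞ :=
  (sphereArea (d - 1))⁻¹ *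
    ∫⁻ v, ∫⁻ θ in Ico 0 (2 * Real.pi), A.indicator 1 (geodesic x v θ) ∂(shrinkageDist p x v t)
      ∂(tangentMeasure x)

/-- The transition probability `H̃(x, A)` of the geodesic shrinkage slice sampler. -/
def shrinkageSliceSampler {d : ℕ} (p : Sphere d → ℝ) (x : Sphere d) (A : Set (Sphere d)) : ℝ≥0∞ :=
  (ENNReal.ofReal (p x))⁻¹ * ∫⁻ t in Ioo 0 (p x), levelKernel p t x A

/-- The target distribution `π(dx) = Z⁻¹ p(x) σ_{d-1}(dx)` with `Z = ∫ p dσ_{d-1}`. -/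
def target {d : ℕ} (p : Sphere d → ℝ) : Measure (Sphere d) :=
  (ENNReal.ofReal (∫ x, p x ∂(sphereMeasure d)))⁻¹ •
    (sphereMeasure d).withDensity fun x => ENNReal.ofReal (p x)

end GeoSlice

end

/-!
The sampler moves along a random great circle, so reversibility is proved on each great circle first
and then transferred to the sphere.

*On a circle.* Let `S` be the acceptance set as seen on the circle. In a run of the shrinkage
procedure from `s` that rejects `z₁, …, zₙ` and then returns `y`, the `k`-th interval is the
component of the circle without `z₁, …, z_k` that contains `s`. As `y` is drawn from the last of
these nested intervals, all of them contain `y` as well, so that the run from `y` with the same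
rejections that returns `s` has the same density. Instead of with densities, this is carried out
with `pairing`, the joint law of start and exit for a start that is uniform on the acceptance set.
Conditioning on the first rejected point gives a recursion (`pairing_succ`) that is visibly
symmetric, whence `pairing_comm` and, for the circle, `circleProb_reversible`.

*On the sphere.* The Liouville measure on the pairs `(x, v)` of a point and a unit tangent vector is
invariant under the geodesic flow (`lintegral_liouville_geodesicFlow`): it is invariant under the
orthogonal group, which acts transitively on the orthonormal pairs and commutes with the flow, so
averaging over the Haar measure of the group proves the claim (`lintegral_comp_of_transitive`).
Hence the start can be averaged along its great circle, and reversibility on the circle yields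
reversibility of each level set kernel with respect to the surface measure on its level set
(`lintegral_liouville_shrinkProb`). Since `p(x) H̃(x, A)` is the integral of the level set kernels
over the levels `0 < t < p(x)`, integrating over `t` gives reversibility with respect to the target.

*Total mass one.* By lower semicontinuity the acceptance set contains a neighbourhood of the start.
Rejected points never enter it, so every draw is accepted with probability bounded below, and the
loop terminates almost surely (`tsum_circleProb`).
-/

noncomputable section

namespace GeoSlice

/-! ### The shrinkage loop on the line -/

/-- The probability that the loop, run with the acceptance set `S` from the interval `(a, b)`
around the start `0` (the next point being drawn uniformly from it), rejects exactly `n` draws and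
then returns a point of `R`. The recursion conditions on the first draw. -/
def acceptProb (S R : Set ℝ) : ℕ → ℝ → ℝ → ℝ≥0∞
  | 0, a, b => ∫⁻ u : unitInterval, (S ∩ R).indicator 1 (a + u * (b - a))
  | n + 1, a, b => ∫⁻ u : unitInterval, Sᶜ.indicator
      (fun z => acceptProb S R n (if z < 0 then z else a) (if z < 0 then b else z))
      (a + u * (b - a))

/-- The probability that the shrinkage procedure with acceptance set `S` rejects exactly `n` draws
and then returns a point of `R`. -/
def circleProb (S R : Set ℝ) : ℕ → ℝ≥0∞
  | 0 => ∫⁻ u : unitInterval, (S ∩ R).indicator 1 (2 * Real.pi * u)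
  | n + 1 => ∫⁻ u : unitInterval,
      Sᶜ.indicator (fun z => acceptProb S R n (z - 2 * Real.pi) z) (2 * Real.pi * u)

/-- Measurability of a family of indicator functions in the parameter, the sets being given as a
measurable subset of a product. -/
theorem measurable_indicator_family {β γ : Type*} [MeasurableSpace β] [MeasurableSpace γ]
    {S : β → Set γ} (hS : MeasurableSet {x : β × γ | x.2 ∈ S x.1}) {f : β → ℝ≥0∞} {z : β → γ}
    (hf : Measurable f) (hz : Measurable z) :
    Measurable fun q => (S q).indicator (fun _ => f q) (z q) := by
  classical
  have h : MeasurableSet {q | z q ∈ S q} := (measurable_id.prodMk hz) hS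
  convert hf.indicator h using 1
  ext q
  simp [indicator]

/-- Joint measurability in the acceptance set, the target set and the interval, for families of
sets that are measurable as subsets of a product. -/
theorem measurable_acceptProb {β : Type*} [MeasurableSpace β] {S R : β → Set ℝ}
    (hS : MeasurableSet {x : β × ℝ | x.2 ∈ S x.1})
    (hR : MeasurableSet {x : β × ℝ | x.2 ∈ R x.1}) (n : ℕ) {a b : β → ℝ}
    (ha : Measurable a) (hb : Measurable b) :
    Measurable fun q => acceptProb (S q) (R q) n (a q) (b q) := by
  induction n generalizing β with
  | zero =>
    simp only [acceptProb]
    refine Measurable.lintegral_prod_right' (f := fun q : β × unitInterval =>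
      (S q.1 ∩ R q.1).indicator 1 (a q.1 + q.2 * (b q.1 - a q.1))) ?_
    have hSR : MeasurableSet {x : (β × unitInterval) × ℝ | x.2 ∈ S x.1.1 ∩ R x.1.1} :=
      (by fun_prop : Measurable fun x : (β × unitInterval) × ℝ => (x.1.1, x.2)) (hS.inter hR)
    exact measurable_indicator_family (S := fun q : β × unitInterval => S q.1 ∩ R q.1) hSR
      (f := fun _ => 1) measurable_const (by fun_prop)
  | succ n ih =>
    simp only [acceptProb]
    refine Measurable.lintegral_prod_right' (f := fun q : β × unitInterval =>
      (S q.1)ᶜ.indicator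
      (fun z => acceptProb (S q.1) (R q.1) n (if z < 0 then z else a q.1)
        (if z < 0 then b q.1 else z)) (a q.1 + q.2 * (b q.1 - a q.1))) ?_
    have hm : Measurable fun x : (β × unitInterval) × ℝ => (x.1.1, x.2) := by fun_prop
    have hz : Measurable fun q : β × unitInterval => a q.1 + q.2 * (b q.1 - a q.1) := by fun_prop
    have hz0 : MeasurableSet {q : β × unitInterval | a q.1 + q.2 * (b q.1 - a q.1) < 0} :=
      measurableSet_lt hz measurable_const
    convert measurable_indicator_family (S := fun q : β × unitInterval => (S q.1)ᶜ)
      (hm hS.compl) (f := fun q => acceptProb (S q.1) (R q.1) n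
        (if a q.1 + q.2 * (b q.1 - a q.1) < 0 then a q.1 + q.2 * (b q.1 - a q.1) else a q.1)
        (if a q.1 + q.2 * (b q.1 - a q.1) < 0 then b q.1 else a q.1 + q.2 * (b q.1 - a q.1)))
      ?_ hz using 1
    · ext q
      simp [indicator]
    · exact ih (S := fun q : β × unitInterval => S q.1) (R := fun q : β × unitInterval => R q.1)
        (hm hS) (hm hR) (Measurable.ite hz0 hz (by fun_prop)) (Measurable.ite hz0 (by fun_prop) hz)

theorem measurable_circleProb {β : Type*} [MeasurableSpace β] {S R : β → Set ℝ}
    (hS : MeasurableSet {x : β × ℝ | x.2 ∈ S x.1})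
    (hR : MeasurableSet {x : β × ℝ | x.2 ∈ R x.1}) (n : ℕ) :
    Measurable fun q => circleProb (S q) (R q) n := by
  have hm : Measurable fun x : (β × unitInterval) × ℝ => (x.1.1, x.2) := by fun_prop
  cases n with
  | zero =>
    simp only [circleProb]
    refine Measurable.lintegral_prod_right' (f := fun q : β × unitInterval =>
      (S q.1 ∩ R q.1).indicator 1 (2 * Real.pi * q.2)) ?_
    exact measurable_indicator_family (S := fun q : β × unitInterval => S q.1 ∩ R q.1)
      (hm (hS.inter hR)) (f := fun _ => 1) measurable_const (by fun_prop)
  | succ n =>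
    simp only [circleProb]
    refine Measurable.lintegral_prod_right' (f := fun q : β × unitInterval =>
      (S q.1)ᶜ.indicator (fun z => acceptProb (S q.1) (R q.1) n (z - 2 * Real.pi) z)
        (2 * Real.pi * q.2)) ?_
    convert measurable_indicator_family (S := fun q : β × unitInterval => (S q.1)ᶜ)
      (hm hS.compl) (f := fun q => acceptProb (S q.1) (R q.1) n
        (2 * Real.pi * q.2 - 2 * Real.pi) (2 * Real.pi * q.2))
      ?_ (z := fun q => 2 * Real.pi * q.2) (by fun_prop) using 1
    · ext q
      simp [indicator]
    · exact measurable_acceptProb (S := fun q : β × unitInterval => S q.1)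
        (R := fun q : β × unitInterval => R q.1) (hm hS) (hm hR) n (by fun_prop) (by fun_prop)

/-- A point `a + u (b - a)` with `u` uniform on `[0, 1]` is uniform on `(a, b]`. -/
theorem lintegral_unitInterval_affine {a b : ℝ} (hab : a < b) (f : ℝ → ℝ≥0∞) :
    ∫⁻ u : unitInterval, f (a + u * (b - a)) =
      (ENNReal.ofReal (b - a))⁻¹ * ∫⁻ z in Ioc a b, f z := by
  have hpos : 0 < b - a := sub_pos.2 hab
  have h1 : ∫⁻ u : unitInterval, f (a + u * (b - a)) =
      ∫⁻ u in Ioc (0 : ℝ) 1, f (a + u * (b - a)) := by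
    rw [setLIntegral_congr Ioc_ae_eq_Icc]
    exact unitInterval.measurePreserving_coe.lintegral_comp_emb
      unitInterval.measurableEmbedding_coe (fun u : ℝ => f (a + u * (b - a)))
  have himg : (fun u : ℝ => a + u * (b - a)) '' Ioc 0 1 = Ioc a b := by
    have := image_affine_Ioc hpos a (0 : ℝ) 1
    simp only [mul_zero, zero_add, mul_one, sub_add_cancel] at this
    rw [← this]
    exact image_congr fun u _ => by ring
  have hinj : InjOn (fun u : ℝ => a + u * (b - a)) (Ioc 0 1) := by
    intro u _ v _ h
    simpa [hpos.ne'] using h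
  have h2 := lintegral_image_eq_lintegral_abs_deriv_mul (s := Ioc (0 : ℝ) 1)
    (f := fun u : ℝ => a + u * (b - a)) (f' := fun _ => b - a) measurableSet_Ioc
    (fun u _ => by simpa using (((hasDerivAt_id u).mul_const (b - a)).const_add a).hasDerivWithinAt)
    hinj f
  rw [himg, abs_of_pos hpos, lintegral_const_mul' _ _ ENNReal.ofReal_ne_top] at h2
  rw [h1, h2, ← mul_assoc, ENNReal.inv_mul_cancel (by simpa using hab) ENNReal.ofReal_ne_top,
    one_mul]

/-! ### The law of the shrinkage procedure -/

/-- The sequence `x, u 0, u 1, …`. -/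
def seqCons (x : unitInterval) (u : ℕ → unitInterval) : ℕ → unitInterval
  | 0 => x
  | n + 1 => u n

/-- An independent uniform sequence remains one when an independent uniform number is put in front
of it. -/
theorem lintegral_uniformSeq {F : (ℕ → unitInterval) → ℝ≥0∞} (hF : Measurable F) :
    ∫⁻ u, F u ∂uniformSeq =
      ∫⁻ x : unitInterval, ∫⁻ u, F (seqCons x u) ∂uniformSeq := by
  have hm : Measurable fun q : unitInterval × (ℕ → unitInterval) =>
      seqCons q.1 q.2 := by
    refine measurable_pi_lambda _ fun n => ?_
    cases n <;> simp only [seqCons] <;> fun_prop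
  have : IsProbabilityMeasure uniformSeq := by unfold uniformSeq; infer_instance
  have key : ((volume : Measure unitInterval).prod uniformSeq).map
      (fun q => seqCons q.1 q.2) = uniformSeq := by
    refine Measure.eq_infinitePi _ fun s t ht => ?_
    classical
    obtain ⟨N, hN⟩ := s.exists_nat_subset_range
    -- Extending the box by trivial factors makes its index set an initial segment.
    let t' : ℕ → Set unitInterval := fun i => if i ∈ s then t i else univ
    have ht' : ∀ i, MeasurableSet (t' i) := fun i => by
      by_cases h : i ∈ s <;> simp [t', h, ht i]
    have hbox : Set.pi (s : Set ℕ) t = Set.pi (Finset.range (N + 1) : Set ℕ) t' := by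
      ext u
      simp only [mem_pi, Finset.mem_coe]
      refine ⟨fun h i _ => ?_, fun h i hi => ?_⟩
      · by_cases his : i ∈ s <;> simp [t', his, h i]
      · simpa [t', hi] using h i (Finset.range_mono N.le_succ (hN hi))
    have hprod : ∏ i ∈ s, (volume : Measure unitInterval) (t i) =
        ∏ i ∈ Finset.range (N + 1), (volume : Measure unitInterval) (t' i) := by
      rw [← Finset.prod_subset (hN.trans (Finset.range_mono N.le_succ))]
      · exact Finset.prod_congr rfl fun i hi => by simp [t', hi]
      · intro i _ hi
        simp [t', hi]
    have hpre : (fun q : unitInterval × (ℕ → unitInterval) =>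
        seqCons q.1 q.2) ⁻¹'
          Set.pi (Finset.range (N + 1) : Set ℕ) t' =
        t' 0 ×ˢ Set.pi (Finset.range N : Set ℕ) fun i => t' (i + 1) := by
      ext ⟨x, u⟩
      simp only [mem_preimage, mem_pi, Finset.mem_coe, Finset.mem_range, mem_prod]
      refine ⟨fun h => ⟨h 0 N.succ_pos, fun i hi => h (i + 1) (by omega)⟩, fun h i hi => ?_⟩
      cases i with
      | zero => exact h.1
      | succ i => exact h.2 i (by omega)
    rw [hbox, hprod, Measure.map_apply hm
      (MeasurableSet.pi (Finset.countable_toSet _) fun i _ => ht' i), hpre, Measure.prod_prod,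
      uniformSeq, Measure.infinitePi_pi _ fun i _ => ht' (i + 1), Finset.prod_range_succ', mul_comm]
  conv_lhs => rw [← key]
  rw [lintegral_map hF hm]
  exact lintegral_prod _ (hF.comp hm).aemeasurable

/-- The variables of the shrinkage procedure after `n` runs of the loop body, started from an
arbitrary state. -/
def loopState (s : ShrinkState) (u : ℕ → unitInterval) : ℕ → ShrinkState
  | 0 => s
  | n + 1 => shrinkStep (loopState s u n) (u n)

/-- The runs of the loop from the state `s` that are left after exactly `n` rejections, at a point
of `R`. -/
def exitsAt (S R : Set ℝ) (s : ShrinkState) (n : ℕ) : Set (ℕ → unitInterval) :=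
  {u | (∀ m < n, (loopState s u m).θ ∉ S) ∧ (loopState s u n).θ ∈ S ∩ R}

theorem loopState_cons_succ (s : ShrinkState) (x : unitInterval) (u : ℕ → unitInterval) (n : ℕ) :
    loopState s (seqCons x u) (n + 1) = loopState (shrinkStep s x) u n := by
  induction n with
  | zero => rfl
  | succ n ih => rw [loopState, ih]; rfl

theorem shrinkState_cons (x : unitInterval) (u : ℕ → unitInterval) (n : ℕ) :
    shrinkState (seqCons x u) n = loopState (shrinkInit x) u n := by
  induction n with
  | zero => rfl
  | succ n ih => rw [shrinkState, ih]; rfl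


theorem measurable_loopState_θ (s : ShrinkState) (n : ℕ) :
    Measurable fun u : ℕ → unitInterval => (loopState s u n).θ := by
  suffices h : (Measurable fun u : ℕ → unitInterval => (loopState s u n).θmin) ∧
      (Measurable fun u : ℕ → unitInterval => (loopState s u n).θmax) ∧
      Measurable fun u : ℕ → unitInterval => (loopState s u n).θ from h.2.2
  induction n with
  | zero =>
    simp only [loopState]
    exact ⟨measurable_const, measurable_const, measurable_const⟩
  | succ n ih =>
    obtain ⟨h1, h2, h3⟩ := ih
    have h0 : MeasurableSet {u : ℕ → unitInterval | (loopState s u n).θ < 0} :=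
      measurableSet_lt h3 measurable_const
    have ha : Measurable fun u : ℕ → unitInterval =>
        if (loopState s u n).θ < 0 then (loopState s u n).θ else (loopState s u n).θmin :=
      Measurable.ite h0 h3 h1
    have hb : Measurable fun u : ℕ → unitInterval =>
        if (loopState s u n).θ < 0 then (loopState s u n).θmax else (loopState s u n).θ :=
      Measurable.ite h0 h2 h3
    have hu : Measurable fun u : ℕ → unitInterval => (u n : ℝ) := by fun_prop
    exact ⟨ha, hb, ha.add (hu.mul (hb.sub ha))⟩

theorem measurable_shrinkState_θ (n : ℕ) :
    Measurable fun u : ℕ → unitInterval => (shrinkState u n).θ := by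
  suffices h : (Measurable fun u : ℕ → unitInterval => (shrinkState u n).θmin) ∧
      (Measurable fun u : ℕ → unitInterval => (shrinkState u n).θmax) ∧
      Measurable fun u : ℕ → unitInterval => (shrinkState u n).θ from h.2.2
  induction n with
  | zero =>
    simp only [shrinkState, shrinkInit]
    refine ⟨?_, ?_, ?_⟩ <;> fun_prop
  | succ n ih =>
    obtain ⟨h1, h2, h3⟩ := ih
    have h0 : MeasurableSet {u : ℕ → unitInterval | (shrinkState u n).θ < 0} :=
      measurableSet_lt h3 measurable_const
    have ha : Measurable fun u : ℕ → unitInterval =>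
        if (shrinkState u n).θ < 0 then (shrinkState u n).θ else (shrinkState u n).θmin :=
      Measurable.ite h0 h3 h1
    have hb : Measurable fun u : ℕ → unitInterval =>
        if (shrinkState u n).θ < 0 then (shrinkState u n).θmax else (shrinkState u n).θ :=
      Measurable.ite h0 h2 h3
    have hu : Measurable fun u : ℕ → unitInterval => (u (n + 1) : ℝ) := by fun_prop
    exact ⟨ha, hb, ha.add (hu.mul (hb.sub ha))⟩

section Law

variable {S R : Set ℝ}

theorem measurableSet_exitsAt (hS : MeasurableSet S) (hR : MeasurableSet R) (s : ShrinkState)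
    (n : ℕ) : MeasurableSet (exitsAt S R s n) := by
  have h : exitsAt S R s n = (⋂ m, ⋂ (_ : m < n), (fun u => (loopState s u m).θ) ⁻¹' Sᶜ) ∩
      (fun u => (loopState s u n).θ) ⁻¹' (S ∩ R) := by
    ext u
    simp [exitsAt]
  rw [h]
  exact (MeasurableSet.iInter fun m => MeasurableSet.iInter fun _ =>
    measurable_loopState_θ s m hS.compl).inter (measurable_loopState_θ s n (hS.inter hR))

instance : IsProbabilityMeasure uniformSeq := by
  unfold uniformSeq
  infer_instance

theorem uniformSeq_exitsAt_zero (s : ShrinkState) :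
    uniformSeq (exitsAt S R s 0) = (S ∩ R).indicator 1 s.θ := by
  by_cases h : s.θ ∈ S ∩ R <;> simp [exitsAt, loopState, h]

theorem uniformSeq_exitsAt_succ (hS : MeasurableSet S) (hR : MeasurableSet R) (s : ShrinkState)
    (n : ℕ) : uniformSeq (exitsAt S R s (n + 1)) =
      Sᶜ.indicator (fun _ => ∫⁻ x : unitInterval, uniformSeq (exitsAt S R (shrinkStep s x) n))
        s.θ := by
  rw [← lintegral_indicator_one (measurableSet_exitsAt hS hR s (n + 1)),
    lintegral_uniformSeq (measurable_one.indicator (measurableSet_exitsAt hS hR s (n + 1)))]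
  by_cases h : s.θ ∈ S
  · have h0 : exitsAt S R s (n + 1) = ∅ := by
      ext u
      exact ⟨fun h' => h'.1 0 n.succ_pos h, fun h' => h'.elim⟩
    simp [h0, h]
  · rw [indicator_of_mem (by simpa using h)]
    refine lintegral_congr fun x => ?_
    rw [← lintegral_indicator_one (measurableSet_exitsAt hS hR _ n)]
    refine lintegral_congr fun u => ?_
    have : seqCons x u ∈ exitsAt S R s (n + 1) ↔ u ∈ exitsAt S R (shrinkStep s x) n := by
      simp only [exitsAt, mem_ofPred_eq, loopState_cons_succ]
      refine and_congr_left fun _ => ⟨fun H m hm => ?_, fun H m hm => ?_⟩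
      · rw [← loopState_cons_succ]
        exact H (m + 1) (by omega)
      · cases m with
        | zero => exact h
        | succ m =>
          rw [loopState_cons_succ]
          exact H m (by omega)
    by_cases hu : u ∈ exitsAt S R (shrinkStep s x) n <;> simp [this, hu]

theorem lintegral_uniformSeq_exitsAt (hS : MeasurableSet S) (hR : MeasurableSet R) (n : ℕ)
    (a b : ℝ) : ∫⁻ x : unitInterval, uniformSeq (exitsAt S R ⟨a, b, a + x * (b - a)⟩ n) =
      acceptProb S R n a b := by
  induction n generalizing a b with
  | zero => simp only [uniformSeq_exitsAt_zero, acceptProb]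
  | succ n ih =>
    simp only [uniformSeq_exitsAt_succ hS hR, acceptProb]
    refine lintegral_congr fun x => ?_
    by_cases h : a + x * (b - a) ∈ S
    · simp [h]
    · rw [indicator_of_mem (by simpa using h), indicator_of_mem (by simpa using h), ← ih]
      rfl

theorem measurableSet_shrinkState_exit (hS : MeasurableSet S) (hR : MeasurableSet R) (n : ℕ) :
    MeasurableSet {u | (∀ m < n, (shrinkState u m).θ ∉ S) ∧ (shrinkState u n).θ ∈ S ∩ R} := by
  have h : {u | (∀ m < n, (shrinkState u m).θ ∉ S) ∧ (shrinkState u n).θ ∈ S ∩ R} =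
      (⋂ m, ⋂ (_ : m < n), (fun u => (shrinkState u m).θ) ⁻¹' Sᶜ) ∩
      (fun u => (shrinkState u n).θ) ⁻¹' (S ∩ R) := by
    ext u
    simp
  rw [h]
  exact (MeasurableSet.iInter fun m => MeasurableSet.iInter fun _ =>
    measurable_shrinkState_θ m hS.compl).inter (measurable_shrinkState_θ n (hS.inter hR))

/-- The runs of the shrinkage procedure that return a point of `R` after exactly `n` rejections
have probability `circleProb S R n`. -/
theorem uniformSeq_shrinkState (hS : MeasurableSet S) (hR : MeasurableSet R) (n : ℕ) :
    uniformSeq {u | (∀ m < n, (shrinkState u m).θ ∉ S) ∧ (shrinkState u n).θ ∈ S ∩ R} =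
      circleProb S R n := by
  have hm := measurableSet_shrinkState_exit hS hR n
  have h1 : uniformSeq {u | (∀ m < n, (shrinkState u m).θ ∉ S) ∧ (shrinkState u n).θ ∈ S ∩ R} =
      ∫⁻ x : unitInterval, uniformSeq (exitsAt S R (shrinkInit x) n) := by
    rw [← lintegral_indicator_one hm, lintegral_uniformSeq (measurable_one.indicator hm)]
    refine lintegral_congr fun x => ?_
    rw [← lintegral_indicator_one (measurableSet_exitsAt hS hR _ n)]
    refine lintegral_congr fun u => ?_
    have : seqCons x u ∈ {u | (∀ m < n, (shrinkState u m).θ ∉ S) ∧ (shrinkState u n).θ ∈ S ∩ R} ↔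
        u ∈ exitsAt S R (shrinkInit x) n := by
      simp only [mem_ofPred_eq, shrinkState_cons, exitsAt]
    by_cases hu : u ∈ exitsAt S R (shrinkInit x) n
    · rw [indicator_of_mem (this.2 hu), indicator_of_mem hu, Pi.one_apply, Pi.one_apply]
    · rw [indicator_of_notMem (mt this.1 hu), indicator_of_notMem hu]
  rw [h1]
  cases n with
  | zero => simp only [uniformSeq_exitsAt_zero, circleProb, shrinkInit]
  | succ n =>
    simp only [uniformSeq_exitsAt_succ hS hR, circleProb]
    refine lintegral_congr fun x => ?_
    by_cases h : 2 * Real.pi * x ∈ S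
    · simp [h, shrinkInit]
    · rw [indicator_of_mem (by simpa [shrinkInit] using h), indicator_of_mem (by simpa using h),
        ← lintegral_uniformSeq_exitsAt hS hR]
      have h0 : ¬ 2 * Real.pi * (x : ℝ) < 0 :=
        not_lt.2 (mul_nonneg Real.two_pi_pos.le x.2.1)
      simp only [shrinkStep, shrinkInit, h0, if_false]

end Law

/-! ### Reversibility of the shrinkage procedure on the circle -/

theorem indicator_eq_indicator_of_iff {α β : Type*} {S : Set α} {T : Set β} {f : α → ℝ≥0∞}
    {g : β → ℝ≥0∞} {x : α} {y : β} (h : x ∈ S ↔ y ∈ T) (hfg : y ∈ T → f x = g y) :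
    S.indicator f x = T.indicator g y := by
  by_cases hy : y ∈ T
  · rw [indicator_of_mem (h.2 hy), indicator_of_mem hy, hfg hy]
  · rw [indicator_of_notMem (mt h.1 hy), indicator_of_notMem hy]

section Circle

variable {S B R : Set ℝ}

/-- The set `S - s`, i.e. `S` as seen from the starting point `s`. -/
def translate (S : Set ℝ) (s : ℝ) : Set ℝ := (fun θ => s + θ) ⁻¹' S

theorem measurableSet_translate (hS : MeasurableSet S) {β : Type*} [MeasurableSpace β] {s : β → ℝ}
    (hs : Measurable s) : MeasurableSet {x : β × ℝ | x.2 ∈ translate S (s x.1)} :=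
  (by fun_prop : Measurable fun x : β × ℝ => s x.1 + x.2) hS

theorem translate_add {T : ℝ} (hS : ∀ θ, θ + T ∈ S ↔ θ ∈ S) (s : ℝ) :
    translate S (s + T) = translate S s := by
  ext θ
  rw [translate, translate, mem_preimage, mem_preimage, ← hS (s + θ)]
  ring_nf

/-- The joint law of start and exit of the loop on `(a, b)` with exactly `n` rejections, evaluated
at `B × R`. The start is distributed according to the Lebesgue measure on `S`, not normalized. -/
def pairing (S B R : Set ℝ) (n : ℕ) (a b : ℝ) : ℝ≥0∞ :=
  ∫⁻ s in Ioc a b, (S ∩ B).indicator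
    (fun s => acceptProb (translate S s) (translate R s) n (a - s) (b - s)) s

theorem measurable_pairing_integrand (hS : MeasurableSet S) (hB : MeasurableSet B)
    (hR : MeasurableSet R) (n : ℕ) {β : Type*} [MeasurableSpace β] {s a b : β → ℝ}
    (hs : Measurable s) (ha : Measurable a) (hb : Measurable b) :
    Measurable fun q => (S ∩ B).indicator
      (fun s => acceptProb (translate S s) (translate R s) n (a q) (b q)) (s q) := by
  have h := measurable_indicator_family (S := fun _ : β => S ∩ B) (measurable_snd (hS.inter hB))
    (measurable_acceptProb (S := fun q => translate S (s q)) (R := fun q => translate R (s q))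
      (measurableSet_translate hS hs) (measurableSet_translate hR hs) n ha hb)
    hs
  convert h using 1
  ext q
  simp [indicator]

theorem setLIntegral_Ioc_sub (a b s : ℝ) (f : ℝ → ℝ≥0∞) :
    ∫⁻ z in Ioc (a - s) (b - s), f (s + z) = ∫⁻ z in Ioc a b, f z := by
  have h := (measurePreserving_add_left volume s).setLIntegral_comp_preimage_emb
    (measurableEmbedding_addLeft s) f (Ioc a b)
  rwa [preimage_const_add_Ioc] at h

theorem setLIntegral_Ioc_reflect (T s : ℝ) (f : ℝ → ℝ≥0∞) :
    ∫⁻ z in Ioc 0 T, f (-z + s) = ∫⁻ z in Ioc (s - T) s, f z := by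
  have h := (Measure.measurePreserving_sub_left volume s).setLIntegral_comp_preimage_emb
    (MeasurableEquiv.subLeft s).measurableEmbedding f (Ico (s - T) s)
  rw [preimage_const_sub_Ico, sub_self, sub_sub_cancel, setLIntegral_congr Ico_ae_eq_Ioc] at h
  simpa only [sub_eq_neg_add] using h

theorem acceptProb_zero_translate {a b : ℝ} (hab : a < b) (s : ℝ) :
    acceptProb (translate S s) (translate R s) 0 (a - s) (b - s) =
      (ENNReal.ofReal (b - a))⁻¹ * ∫⁻ z in Ioc a b, (S ∩ R).indicator 1 z := by
  rw [acceptProb, lintegral_unitInterval_affine (by linarith), sub_sub_sub_cancel_right,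
    ← setLIntegral_Ioc_sub a b s]
  rfl

theorem acceptProb_succ_translate {a b : ℝ} (hab : a < b) (s : ℝ) (n : ℕ) :
    acceptProb (translate S s) (translate R s) (n + 1) (a - s) (b - s) =
      (ENNReal.ofReal (b - a))⁻¹ * ∫⁻ z in Ioc a b, Sᶜ.indicator (fun z =>
        acceptProb (translate S s) (translate R s) n
          (if z < s then z - s else a - s) (if z < s then b - s else z - s)) z := by
  rw [acceptProb, lintegral_unitInterval_affine (by linarith), sub_sub_sub_cancel_right,
    ← setLIntegral_Ioc_sub a b s]
  congr 1
  refine lintegral_congr fun z => ?_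
  have h1 : (s + z < s) = (z < 0) := by simp
  refine indicator_eq_indicator_of_iff Iff.rfl fun _ => ?_
  simp only [h1, add_sub_cancel_left]

theorem pairing_zero {a b : ℝ} (hab : a < b) (hS : MeasurableSet S) (hB : MeasurableSet B) :
    pairing S B R 0 a b = (ENNReal.ofReal (b - a))⁻¹ *
      ((∫⁻ z in Ioc a b, (S ∩ B).indicator 1 z) * ∫⁻ z in Ioc a b, (S ∩ R).indicator 1 z) := by
  simp only [pairing, acceptProb_zero_translate hab]
  set c := (ENNReal.ofReal (b - a))⁻¹ * ∫⁻ z in Ioc a b, (S ∩ R).indicator 1 z with hc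
  have : (fun s => (S ∩ B).indicator (fun _ : ℝ => c) s) =
      fun s => (S ∩ B).indicator 1 s * c := by
    ext s
    by_cases h : s ∈ S ∩ B <;> simp [h]
  rw [this, lintegral_mul_const _ (measurable_one.indicator (hS.inter hB)), hc]
  ring

/-- After the first rejection, at `z`, the loop goes on in the one of the intervals `(a, z)` and
`(z, b)` that contains the start. -/
theorem pairing_succ {a b : ℝ} (hab : a < b) (hS : MeasurableSet S) (hB : MeasurableSet B)
    (hR : MeasurableSet R) (n : ℕ) :
    pairing S B R (n + 1) a b = (ENNReal.ofReal (b - a))⁻¹ *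
      ∫⁻ z in Ioc a b, Sᶜ.indicator (fun z => pairing S B R n a z + pairing S B R n z b) z := by
  have hne : (ENNReal.ofReal (b - a))⁻¹ ≠ ∞ := by simpa using hab
  -- `F s z` is the contribution of the start `s` and of the first rejection at `z`.
  set F : ℝ → ℝ → ℝ≥0∞ := fun s z => Sᶜ.indicator (fun z => (S ∩ B).indicator (fun s =>
    acceptProb (translate S s) (translate R s) n
      (if z < s then z - s else a - s) (if z < s then b - s else z - s)) s) z with hF
  have h1 : pairing S B R (n + 1) a b =
      (ENNReal.ofReal (b - a))⁻¹ * ∫⁻ s in Ioc a b, ∫⁻ z in Ioc a b, F s z := by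
    rw [pairing, ← lintegral_const_mul' _ _ hne]
    refine lintegral_congr fun s => ?_
    by_cases h : s ∈ S ∩ B
    · rw [indicator_of_mem h, acceptProb_succ_translate hab]
      simp only [hF, indicator_of_mem h]
    · simp [hF, indicator_of_notMem h]
  have hFm : Measurable (Function.uncurry F) := by
    have hlt : MeasurableSet {q : ℝ × ℝ | q.2 < q.1} :=
      measurableSet_lt measurable_snd measurable_fst
    have ha : Measurable fun q : ℝ × ℝ => if q.2 < q.1 then q.2 - q.1 else a - q.1 :=
      Measurable.ite hlt (by fun_prop) (by fun_prop)
    have hb : Measurable fun q : ℝ × ℝ => if q.2 < q.1 then b - q.1 else q.2 - q.1 :=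
      Measurable.ite hlt (by fun_prop) (by fun_prop)
    have h := (measurable_pairing_integrand hS hB hR n measurable_fst ha hb).indicator
      (measurable_snd hS.compl)
    convert h using 1
    ext ⟨s, z⟩
    simp only [Function.uncurry_apply_pair, hF]
    exact indicator_eq_indicator_of_iff Iff.rfl fun _ => rfl
  rw [h1, lintegral_lintegral_swap hFm.aemeasurable]
  congr 1
  refine setLIntegral_congr_fun measurableSet_Ioc fun z hz => ?_
  by_cases hzS : z ∈ S
  · simp [hF, hzS]
  · simp only [hF]
    rw [indicator_of_mem (by simpa using hzS)]
    simp only [indicator_of_mem (show z ∈ Sᶜ from hzS)]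
    rw [← Ioc_union_Ioc_eq_Ioc hz.1.le hz.2, lintegral_union measurableSet_Ioc
      (Ioc_disjoint_Ioc_of_le le_rfl)]
    congr 1
    · refine setLIntegral_congr_fun measurableSet_Ioc fun s hs => ?_
      exact indicator_eq_indicator_of_iff Iff.rfl fun _ => by simp only [if_neg (not_lt.2 hs.2)]
    · refine setLIntegral_congr_fun measurableSet_Ioc fun s hs => ?_
      exact indicator_eq_indicator_of_iff Iff.rfl fun _ => by simp only [if_pos hs.1]

/-- Start and exit of the loop are exchangeable: at every rejection they lie on the same side of the
rejected point, so the loop passes through the same intervals when they are swapped. -/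
theorem pairing_comm (hS : MeasurableSet S) (hB : MeasurableSet B) (hR : MeasurableSet R) (n : ℕ)
    (a b : ℝ) : pairing S B R n a b = pairing S R B n a b := by
  induction n generalizing a b with
  | zero =>
    rcases le_or_gt b a with h | h
    · simp [pairing, h]
    · rw [pairing_zero h hS hB, pairing_zero h hS hR]
      ring
  | succ n ih =>
    rcases le_or_gt b a with h | h
    · simp [pairing, h]
    · rw [pairing_succ h hS hB hR, pairing_succ h hS hR hB]
      simp only [ih]

theorem setLIntegral_Ioc_periodic {f : ℝ → ℝ≥0∞} {T : ℝ} (hT : 0 < T) (hf : Function.Periodic f T)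
    (c : ℝ) : ∫⁻ x in Ioc 0 T, f (c + x) = ∫⁻ x in Ioc 0 T, f x := by
  have h1 := setLIntegral_Ioc_sub c (c + T) c f
  rw [sub_self, add_sub_cancel_left] at h1
  rw [h1]
  have h2 := (isAddFundamentalDomain_Ioc hT c).setLIntegral_eq
    (by simpa using isAddFundamentalDomain_Ioc hT 0) f ?_
  · simpa using h2
  · exact fun g x => hf.map_vadd_zmultiples g x

theorem circleProb_zero_translate (hS : ∀ θ, θ + 2 * Real.pi ∈ S ↔ θ ∈ S)
    (hR : ∀ θ, θ + 2 * Real.pi ∈ R ↔ θ ∈ R) (s : ℝ) :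
    circleProb (translate S s) (translate R s) 0 =
      (ENNReal.ofReal (2 * Real.pi))⁻¹ * ∫⁻ z in Ioc 0 (2 * Real.pi), (S ∩ R).indicator 1 z := by
  have h := lintegral_unitInterval_affine Real.two_pi_pos
    ((translate S s ∩ translate R s).indicator 1)
  simp only [zero_add, sub_zero, mul_comm _ (2 * Real.pi)] at h
  rw [circleProb, h]
  congr 1
  refine setLIntegral_Ioc_periodic (f := (S ∩ R).indicator 1) Real.two_pi_pos (fun θ => ?_) s
  exact indicator_eq_indicator_of_iff (and_congr (hS θ) (hR θ)) fun _ => rfl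

/-- The shrinkage procedure on the circle is reversible with respect to the uniform distribution on
the acceptance set. -/
theorem circleProb_reversible (hS : MeasurableSet S) (hB : MeasurableSet B) (hR : MeasurableSet R)
    (hS' : ∀ θ, θ + 2 * Real.pi ∈ S ↔ θ ∈ S) (hB' : ∀ θ, θ + 2 * Real.pi ∈ B ↔ θ ∈ B)
    (hR' : ∀ θ, θ + 2 * Real.pi ∈ R ↔ θ ∈ R) (n : ℕ) :
    ∫⁻ s in Ioc 0 (2 * Real.pi),
        (S ∩ B).indicator (fun s => circleProb (translate S s) (translate R s) n) s =
      ∫⁻ s in Ioc 0 (2 * Real.pi),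
        (S ∩ R).indicator (fun s => circleProb (translate S s) (translate B s) n) s := by
  cases n with
  | zero =>
    have key : ∀ {B R : Set ℝ}, MeasurableSet B → (∀ θ, θ + 2 * Real.pi ∈ R ↔ θ ∈ R) →
        ∫⁻ s in Ioc 0 (2 * Real.pi),
          (S ∩ B).indicator (fun s => circleProb (translate S s) (translate R s) 0) s =
        (ENNReal.ofReal (2 * Real.pi))⁻¹ *
          ((∫⁻ z in Ioc 0 (2 * Real.pi), (S ∩ B).indicator 1 z) *
            ∫⁻ z in Ioc 0 (2 * Real.pi), (S ∩ R).indicator 1 z) := by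
      intro B R hB hR'
      simp only [circleProb_zero_translate hS' hR']
      set c := (ENNReal.ofReal (2 * Real.pi))⁻¹ *
        ∫⁻ z in Ioc 0 (2 * Real.pi), (S ∩ R).indicator 1 z with hc
      have : (fun s => (S ∩ B).indicator (fun _ : ℝ => c) s) =
          fun s => (S ∩ B).indicator 1 s * c := by
        ext s
        by_cases h : s ∈ S ∩ B <;> simp [h]
      rw [this, lintegral_mul_const _ (measurable_one.indicator (hS.inter hB)), hc]
      ring
    rw [key hB hR', key hR hB']
    ring
  | succ n =>
    have key : ∀ {B R : Set ℝ}, MeasurableSet B → MeasurableSet R →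
        (∀ θ, θ + 2 * Real.pi ∈ B ↔ θ ∈ B) → (∀ θ, θ + 2 * Real.pi ∈ R ↔ θ ∈ R) →
        ∫⁻ s in Ioc 0 (2 * Real.pi),
          (S ∩ B).indicator (fun s => circleProb (translate S s) (translate R s) (n + 1)) s =
        (ENNReal.ofReal (2 * Real.pi))⁻¹ * ∫⁻ z in Ioc 0 (2 * Real.pi),
          Sᶜ.indicator (fun z => pairing S B R n (z - 2 * Real.pi) z) z := by
      intro B R hB hR hB' hR'
      -- `H s z` is the contribution of the start `s` and of the first rejection at `z`.
      set H : ℝ → ℝ → ℝ≥0∞ := fun s z => Sᶜ.indicator (fun z => (S ∩ B).indicator (fun s =>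
        acceptProb (translate S s) (translate R s) n (z - 2 * Real.pi - s) (z - s)) s) z with hH
      have hHm : Measurable (Function.uncurry H) := by
        have h := (measurable_pairing_integrand hS hB hR n (β := ℝ × ℝ) measurable_fst
          (a := fun q => q.2 - 2 * Real.pi - q.1) (b := fun q => q.2 - q.1) (by fun_prop)
          (by fun_prop)).indicator (measurable_snd hS.compl)
        convert h using 1
        ext ⟨s, z⟩
        simp only [Function.uncurry_apply_pair, hH]
        exact indicator_eq_indicator_of_iff Iff.rfl fun _ => rfl
      have hper : ∀ s z, H (s + 2 * Real.pi) (z + 2 * Real.pi) = H s z := by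
        intro s z
        refine indicator_eq_indicator_of_iff (not_congr (hS' z)) fun _ =>
          indicator_eq_indicator_of_iff (and_congr (hS' s) (hB' s)) fun _ => ?_
        rw [translate_add hS', translate_add hR']
        ring_nf
      have hne : (ENNReal.ofReal (2 * Real.pi))⁻¹ ≠ ∞ := by simp [Real.pi_pos]
      have h1 : ∫⁻ s in Ioc 0 (2 * Real.pi),
          (S ∩ B).indicator (fun s => circleProb (translate S s) (translate R s) (n + 1)) s =
          (ENNReal.ofReal (2 * Real.pi))⁻¹ * ∫⁻ s in Ioc 0 (2 * Real.pi),
            ∫⁻ z in Ioc 0 (2 * Real.pi), H s (s + z) := by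
        rw [← lintegral_const_mul' _ _ hne]
        refine lintegral_congr fun s => ?_
        by_cases h : s ∈ S ∩ B
        · have h2 := lintegral_unitInterval_affine Real.two_pi_pos ((translate S s)ᶜ.indicator
            (fun z => acceptProb (translate S s) (translate R s) n (z - 2 * Real.pi) z))
          simp only [zero_add, sub_zero, mul_comm _ (2 * Real.pi)] at h2
          rw [indicator_of_mem h, circleProb, h2]
          congr 1
          refine lintegral_congr fun z => ?_
          simp only [hH, indicator_of_mem h]
          have e1 : s + z - 2 * Real.pi - s = z - 2 * Real.pi := by ring
          refine indicator_eq_indicator_of_iff Iff.rfl fun _ => ?_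
          rw [e1, add_sub_cancel_left]
        · simp [hH, indicator_of_notMem h]
      rw [h1, lintegral_lintegral_swap (by fun_prop)]
      -- By periodicity the position of the first rejection can serve as the integration variable.
      have h2 : ∀ z, ∫⁻ s in Ioc 0 (2 * Real.pi), H s (s + z) =
          ∫⁻ s in Ioc 0 (2 * Real.pi), H (-z + s) s := by
        intro z
        rw [← setLIntegral_Ioc_periodic (f := fun s => H s (s + z)) Real.two_pi_pos
          (fun s => by
            show H (s + 2 * Real.pi) (s + 2 * Real.pi + z) = H s (s + z)
            rw [← hper s, add_right_comm]) (-z)]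
        simp only [neg_add_cancel_comm]
      simp only [h2]
      rw [lintegral_lintegral_swap (by fun_prop)]
      congr 1
      refine lintegral_congr fun s => ?_
      by_cases hsS : s ∈ S
      · simp [hH, hsS]
      · rw [indicator_of_mem (by simpa using hsS), pairing,
          ← setLIntegral_Ioc_reflect (2 * Real.pi) s]
        refine lintegral_congr fun z => ?_
        simp only [hH]
        rw [indicator_of_mem (by simpa using hsS)]
    rw [key hB hR hB' hR', key hR hB hR' hB']
    simp only [pairing_comm hS hB hR]

end Circle

/-! ### Termination of the shrinkage procedure -/

/-- The probability that the loop, run with the acceptance set `S` from the interval `(a, b)`,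
rejects the first `n` draws. -/
def rejectProb (S : Set ℝ) : ℕ → ℝ → ℝ → ℝ≥0∞
  | 0, _, _ => 1
  | n + 1, a, b => ∫⁻ u : unitInterval, Sᶜ.indicator
      (fun z => rejectProb S n (if z < 0 then z else a) (if z < 0 then b else z))
      (a + u * (b - a))

section Termination

variable {S : Set ℝ}

theorem measurable_indicator_acceptProb (hS : MeasurableSet S) (n : ℕ) (a b : ℝ) :
    Measurable fun z : ℝ => Sᶜ.indicator (fun z => acceptProb S univ n
      (if z < 0 then z else a) (if z < 0 then b else z)) z := by
  refine Measurable.indicator ?_ hS.compl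
  have h0 : MeasurableSet {z : ℝ | z < 0} := measurableSet_Iio
  exact measurable_acceptProb (S := fun _ => S) (R := fun _ => univ) (measurable_snd hS)
    (measurable_snd MeasurableSet.univ) n (Measurable.ite h0 measurable_id measurable_const)
    (Measurable.ite h0 measurable_const measurable_id)

theorem sum_acceptProb_add_rejectProb (hS : MeasurableSet S) (n : ℕ) (a b : ℝ) :
    ∑ m ∈ Finset.range n, acceptProb S univ m a b + rejectProb S n a b = 1 := by
  induction n generalizing a b with
  | zero => simp [rejectProb]
  | succ n ih =>
    have hz : Measurable fun u : unitInterval => a + (u : ℝ) * (b - a) := by fun_prop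
    have hm : ∀ m, Measurable fun u : unitInterval => Sᶜ.indicator (fun z => acceptProb S univ m
        (if z < 0 then z else a) (if z < 0 then b else z)) (a + (u : ℝ) * (b - a)) := fun m =>
      (measurable_indicator_acceptProb hS m a b).comp hz
    have hm0 : Measurable fun u : unitInterval =>
        (S ∩ univ).indicator (1 : ℝ → ℝ≥0∞) (a + (u : ℝ) * (b - a)) :=
      (measurable_one.indicator (hS.inter MeasurableSet.univ)).comp hz
    rw [Finset.sum_range_succ', add_right_comm]
    simp only [acceptProb, rejectProb]
    rw [← lintegral_finsetSum _ fun m _ => hm m,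
      ← lintegral_add_left (Finset.measurable_sum _ fun m _ => hm m),
      ← lintegral_add_right _ hm0]
    have : ∀ u : unitInterval, (∑ m ∈ Finset.range n, Sᶜ.indicator (fun z => acceptProb S univ m
        (if z < 0 then z else a) (if z < 0 then b else z)) (a + u * (b - a)) +
        Sᶜ.indicator (fun z => rejectProb S n (if z < 0 then z else a) (if z < 0 then b else z))
          (a + u * (b - a))) + (S ∩ univ).indicator 1 (a + u * (b - a)) = (1 : ℝ≥0∞) := by
      intro u
      by_cases h : a + u * (b - a) ∈ S
      · simp [h]
      · simp only [indicator_of_mem (show a + u * (b - a) ∈ Sᶜ from h), ih]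
        simp [h]
    simp only [this]
    simp

/-- A draw from `(a, b) ⊇ (-δ, δ)` is rejected with probability at most
`1 - 2δ / (b - a) ≤ 1 - δ / π`. -/
theorem lintegral_compl_indicator_le {δ a b : ℝ} (hδ : 0 < δ)
    (hSδ : Ioo (-δ) δ ⊆ S) (ha : a ≤ -δ) (hb : δ ≤ b) (hab : b - a ≤ 2 * Real.pi) :
    ∫⁻ u : unitInterval, Sᶜ.indicator 1 (a + u * (b - a)) ≤ ENNReal.ofReal (1 - δ / Real.pi) := by
  have hpos : 0 < b - a := by linarith
  rw [lintegral_unitInterval_affine (by linarith), ← ENNReal.ofReal_inv_of_pos hpos]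
  have h1 : ∫⁻ z in Ioc a b, Sᶜ.indicator 1 z ≤ ENNReal.ofReal (b - a - 2 * δ) := by
    calc ∫⁻ z in Ioc a b, Sᶜ.indicator 1 z
        ≤ ∫⁻ z in Ioc a b, (Iic (-δ) ∪ Ici δ).indicator 1 z := by
          refine lintegral_mono fun z => indicator_le_indicator_of_subset (fun y hy => ?_)
            (fun _ => zero_le) z
          by_contra hy'
          simp only [mem_union, mem_Iic, mem_Ici, not_or, not_le] at hy'
          exact hy (hSδ hy')
      _ = volume ((Iic (-δ) ∪ Ici δ) ∩ Ioc a b) := by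
          rw [lintegral_indicator_one (measurableSet_Iic.union measurableSet_Ici),
            Measure.restrict_apply (measurableSet_Iic.union measurableSet_Ici)]
      _ ≤ volume (Icc a (-δ) ∪ Icc δ b) := by
          refine measure_mono fun z hz => ?_
          rcases hz.1 with h | h
          · exact Or.inl ⟨hz.2.1.le, h⟩
          · exact Or.inr ⟨h, hz.2.2⟩
      _ ≤ ENNReal.ofReal (b - a - 2 * δ) := by
          refine (measure_union_le _ _).trans ?_
          rw [Real.volume_Icc, Real.volume_Icc, ← ENNReal.ofReal_add (by linarith) (by linarith)]
          exact ENNReal.ofReal_le_ofReal (by linarith)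
  refine (mul_le_mul_right h1 _).trans ?_
  rw [← ENNReal.ofReal_mul (inv_nonneg.2 hpos.le)]
  refine ENNReal.ofReal_le_ofReal ?_
  have h2 : δ / Real.pi ≤ 2 * δ / (b - a) := by
    rw [div_le_div_iff₀ Real.pi_pos hpos]
    nlinarith
  have h3 : (b - a)⁻¹ * (b - a - 2 * δ) = 1 - 2 * δ / (b - a) := by
    field_simp
  linarith

theorem rejectProb_le {δ : ℝ} (hδ : 0 < δ) (hS : MeasurableSet S) (hSδ : Ioo (-δ) δ ⊆ S) (n : ℕ)
    {a b : ℝ} (ha : a ≤ -δ) (hb : δ ≤ b) (hab : b - a ≤ 2 * Real.pi) :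
    rejectProb S n a b ≤ ENNReal.ofReal (1 - δ / Real.pi) ^ n := by
  induction n generalizing a b with
  | zero => simp [rejectProb]
  | succ n ih =>
    have hpos : 0 < b - a := by linarith
    rw [rejectProb, pow_succ]
    calc ∫⁻ u : unitInterval, Sᶜ.indicator (fun z => rejectProb S n
            (if z < 0 then z else a) (if z < 0 then b else z)) (a + u * (b - a))
        ≤ ∫⁻ u : unitInterval, ENNReal.ofReal (1 - δ / Real.pi) ^ n *
            Sᶜ.indicator 1 (a + u * (b - a)) := by
          refine lintegral_mono fun u => ?_
          by_cases h : a + u * (b - a) ∈ S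
          · simp [h]
          · simp only [indicator_of_mem (show a + u * (b - a) ∈ Sᶜ from h), Pi.one_apply, mul_one]
            have h1 : a ≤ a + u * (b - a) :=
              le_add_of_nonneg_right (mul_nonneg u.2.1 hpos.le)
            have h2 : a + u * (b - a) ≤ b := by nlinarith [u.2.2]
            by_cases h0 : a + u * (b - a) < 0
            · simp only [h0, if_true]
              refine ih (not_lt.1 fun h3 => h (hSδ ⟨h3, h0.trans hδ⟩)) hb (by linarith)
            · simp only [h0, if_false]
              refine ih ha (not_lt.1 fun h3 => h (hSδ ⟨by linarith, h3⟩)) (by linarith)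
      _ = ENNReal.ofReal (1 - δ / Real.pi) ^ n *
            ∫⁻ u : unitInterval, Sᶜ.indicator 1 (a + u * (b - a)) :=
          lintegral_const_mul _ ((measurable_one.indicator hS.compl).comp
            (by fun_prop : Measurable fun u : unitInterval => a + (u : ℝ) * (b - a)))
      _ ≤ _ := mul_le_mul_right (lintegral_compl_indicator_le hδ hSδ ha hb hab) _

theorem tsum_acceptProb {δ : ℝ} (hδ : 0 < δ) (hS : MeasurableSet S) (hSδ : Ioo (-δ) δ ⊆ S)
    {a b : ℝ} (ha : a ≤ -δ) (hb : δ ≤ b) (hab : b - a ≤ 2 * Real.pi) :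
    ∑' n, acceptProb S univ n a b = 1 := by
  have hlt : ENNReal.ofReal (1 - δ / Real.pi) < 1 := by
    rw [ENNReal.ofReal_lt_one]
    have := div_pos hδ Real.pi_pos
    linarith
  have h1 : Filter.Tendsto (fun n => rejectProb S n a b) Filter.atTop (nhds 0) :=
    tendsto_of_tendsto_of_tendsto_of_le_of_le tendsto_const_nhds
      (ENNReal.tendsto_pow_atTop_nhds_zero_of_lt_one hlt) (fun _ => zero_le)
      fun n => rejectProb_le hδ hS hSδ n ha hb hab
  have h2 :=
    (ENNReal.summable (f := fun n => acceptProb S univ n a b)).hasSum.tendsto_sum_nat.add h1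
  simp only [sum_acceptProb_add_rejectProb hS, add_zero] at h2
  exact tendsto_nhds_unique h2 tendsto_const_nhds

/-- The shrinkage procedure terminates almost surely if the acceptance set contains a neighbourhood
of the start: no rejection can cut into this neighbourhood, so that every draw is accepted with a
probability bounded below. -/
theorem tsum_circleProb {δ : ℝ} (hδ : 0 < δ) (hS : MeasurableSet S) (hSδ : Ioo (-δ) δ ⊆ S)
    (hS' : ∀ θ, θ + 2 * Real.pi ∈ S ↔ θ ∈ S) : ∑' n, circleProb S univ n = 1 := by
  have hz : Measurable fun u : unitInterval => 2 * Real.pi * (u : ℝ) := by fun_prop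
  have hm : ∀ n, Measurable fun u : unitInterval => Sᶜ.indicator
      (fun z => acceptProb S univ n (z - 2 * Real.pi) z) (2 * Real.pi * (u : ℝ)) := fun n =>
    ((measurable_acceptProb (S := fun _ => S) (R := fun _ => univ) (measurable_snd hS)
      (measurable_snd MeasurableSet.univ) n (by fun_prop) measurable_id).indicator hS.compl).comp
      hz
  have hm0 : Measurable fun u : unitInterval =>
      (S ∩ univ).indicator (1 : ℝ → ℝ≥0∞) (2 * Real.pi * (u : ℝ)) :=
    (measurable_one.indicator (hS.inter MeasurableSet.univ)).comp hz
  rw [tsum_eq_zero_add' ENNReal.summable]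
  simp only [circleProb]
  rw [← lintegral_tsum fun n => (hm n).aemeasurable,
    ← lintegral_add_left hm0]
  have : ∀ u : unitInterval, (S ∩ univ).indicator 1 (2 * Real.pi * (u : ℝ)) +
      ∑' n, Sᶜ.indicator (fun z => acceptProb S univ n (z - 2 * Real.pi) z)
        (2 * Real.pi * (u : ℝ)) = (1 : ℝ≥0∞) := by
    intro u
    by_cases h : 2 * Real.pi * (u : ℝ) ∈ S
    · simp [h]
    · have h0 : 0 ≤ 2 * Real.pi * (u : ℝ) := mul_nonneg Real.two_pi_pos.le u.2.1
      have h1 : 2 * Real.pi * (u : ℝ) ≤ 2 * Real.pi :=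
        mul_le_of_le_one_right Real.two_pi_pos.le u.2.2
      simp only [indicator_of_mem (show 2 * Real.pi * (u : ℝ) ∈ Sᶜ from h)]
      rw [tsum_acceptProb hδ hS hSδ]
      · simp [h]
      · refine not_lt.1 fun h3 => h ?_
        rw [← sub_add_cancel (2 * Real.pi * (u : ℝ)) (2 * Real.pi), hS']
        exact hSδ ⟨h3, by linarith⟩
      · exact not_lt.1 fun h3 => h (hSδ ⟨by linarith, h3⟩)
      · linarith
  simp only [this]
  simp

end Termination

/-! ### Invariance of the surface measures under isometries -/

open scoped Pointwise in
theorem smul_image_coe_sphere_preimage {V W : Type*} [NormedAddCommGroup V]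
    [InnerProductSpace ℝ V] [NormedAddCommGroup W] [InnerProductSpace ℝ W] (h : V ≃ₗᵢ[ℝ] W)
    (A : Set (Metric.sphere (0 : W) 1))
    (h' : Metric.sphere (0 : V) 1 → Metric.sphere (0 : W) 1) (hh : ∀ v, (h' v : W) = h v) :
    Ioo (0 : ℝ) 1 • ((↑) '' (h' ⁻¹' A) : Set V) = h ⁻¹' (Ioo (0 : ℝ) 1 • ((↑) '' A)) := by
  ext y
  simp only [mem_smul, mem_image, mem_preimage]
  constructor
  · rintro ⟨r, hr, _, ⟨v, hv, rfl⟩, rfl⟩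
    exact ⟨r, hr, h v, ⟨h' v, hv, hh v⟩, by simp⟩
  · rintro ⟨r, hr, _, ⟨w, hw, rfl⟩, hy⟩
    have hw1 : h.symm (w : W) ∈ Metric.sphere (0 : V) 1 := by simp
    refine ⟨r, hr, h.symm w, ⟨⟨h.symm w, hw1⟩, ?_, rfl⟩, ?_⟩
    · have : h' ⟨h.symm w, hw1⟩ = w := Subtype.ext (by rw [hh]; simp)
      simpa [this] using hw
    · apply h.injective
      simp [hy]

/-- A linear isometry maps the surface measure of the unit sphere to the surface measure. -/
theorem map_toSphere {V W : Type*} [NormedAddCommGroup V] [InnerProductSpace ℝ V]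
    [FiniteDimensional ℝ V] [MeasurableSpace V] [BorelSpace V] [NormedAddCommGroup W]
    [InnerProductSpace ℝ W] [FiniteDimensional ℝ W] [MeasurableSpace W] [BorelSpace W]
    (h : V ≃ₗᵢ[ℝ] W) :
    (volume : Measure V).toSphere.map (fun v : Metric.sphere (0 : V) 1 => h v) =
      (volume : Measure W).toSphere.map ((↑) : Metric.sphere (0 : W) 1 → W) := by
  let h' : Metric.sphere (0 : V) 1 → Metric.sphere (0 : W) 1 := fun v => ⟨h v, by simp⟩
  have hh'm : Measurable h' := Measurable.subtype_mk (by fun_prop)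
  have key : (volume : Measure V).toSphere.map h' = (volume : Measure W).toSphere := by
    ext A hA
    rw [Measure.map_apply hh'm hA, Measure.toSphere_apply' _ (hh'm hA),
      Measure.toSphere_apply' _ hA, smul_image_coe_sphere_preimage h A h' fun _ => rfl,
      h.toLinearEquiv.finrank_eq]
    congr 1
    exact h.measurePreserving.measure_preimage_emb h.toHomeomorph.measurableEmbedding _
  rw [← key, Measure.map_map measurable_subtype_coe hh'm]
  rfl

section Sphere

variable {d : ℕ}

/-- The volume measure `μ_x` of the great subsphere with pole `x`, as a measure on `ℝ^d`. -/
def tangentMeasureE (x : Sphere d) : Measure (E d) :=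
  (tangentMeasure x).map fun v : TangentSphere x => ((v : TangentSpaceAt x) : E d)

theorem measurable_coe_coe (x : Sphere d) :
    Measurable fun v : TangentSphere x => ((v : TangentSpaceAt x) : E d) :=
  measurable_subtype_coe.comp measurable_subtype_coe

instance (x : Sphere d) : IsFiniteMeasure (tangentMeasure x) := by
  unfold tangentMeasure
  infer_instance

instance (x : Sphere d) : IsFiniteMeasure (tangentMeasureE x) := by
  unfold tangentMeasureE
  infer_instance

instance : IsFiniteMeasure (sphereMeasure d) := by
  unfold sphereMeasure
  infer_instance

/-- The action of a linear isometry on the unit sphere. -/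
def sphereMap (g : E d ≃ₗᵢ[ℝ] E d) (x : Sphere d) : Sphere d := ⟨g x, by simp⟩

theorem measurable_sphereMap (g : E d ≃ₗᵢ[ℝ] E d) : Measurable (sphereMap g) :=
  Measurable.subtype_mk (by fun_prop)

theorem map_tangentMeasureE (g : E d ≃ₗᵢ[ℝ] E d) (x : Sphere d) :
    (tangentMeasureE x).map g = tangentMeasureE (sphereMap g x) := by
  have hg : (TangentSpaceAt x).map (g.toLinearEquiv : E d →ₗ[ℝ] E d) =
      TangentSpaceAt (sphereMap g x) := by
    rw [Submodule.map_orthogonal_equiv, Submodule.map_span, image_singleton]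
    rfl
  have h := map_toSphere ((g.submoduleMap (TangentSpaceAt x)).trans
    (LinearIsometryEquiv.ofEq _ _ hg))
  rw [tangentMeasureE, tangentMeasureE, Measure.map_map (by fun_prop) (measurable_coe_coe x)]
  have h2 := congrArg (Measure.map ((↑) : TangentSpaceAt (sphereMap g x) → E d)) h
  rw [Measure.map_map measurable_subtype_coe (by fun_prop), Measure.map_map measurable_subtype_coe
    measurable_subtype_coe] at h2
  exact h2

theorem map_sphereMeasure (g : E d ≃ₗᵢ[ℝ] E d) :
    (sphereMeasure d).map (sphereMap g) = sphereMeasure d := by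
  have h := map_toSphere g
  have hemb : MeasurableEmbedding ((↑) : Sphere d → E d) :=
    MeasurableEmbedding.subtype_coe Metric.isClosed_sphere.measurableSet
  have h2 : ((sphereMeasure d).map (sphereMap g)).map ((↑) : Sphere d → E d) =
      (sphereMeasure d).map ((↑) : Sphere d → E d) := by
    rw [Measure.map_map measurable_subtype_coe (measurable_sphereMap g)]
    exact h
  rw [← hemb.comap_map ((sphereMeasure d).map (sphereMap g)), h2, hemb.comap_map]

theorem tangentMeasure_univ (hd : 3 ≤ d) (x : Sphere d) :
    tangentMeasure x univ = sphereArea (d - 1) := by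
  have hx : (x : E d) ≠ 0 := ne_zero_of_mem_unit_sphere x
  have : Fact (Module.finrank ℝ (E d) = (d - 1) + 1) := ⟨by simp; omega⟩
  have h := congrArg (fun μ : Measure (E (d - 1)) => μ univ)
    (map_toSphere (OrthonormalBasis.fromOrthogonalSpanSingleton (d - 1) hx).repr)
  rw [Measure.map_apply (by fun_prop) MeasurableSet.univ,
    Measure.map_apply measurable_subtype_coe MeasurableSet.univ, preimage_univ, preimage_univ] at h
  exact h

/-- The reflection that exchanges the unit vectors `e` and `x`. -/
def swapReflection (e x : Sphere d) : E d ≃ₗᵢ[ℝ] E d :=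
  (ℝ ∙ ((e : E d) - x))ᗮ.reflection

theorem sphereMap_swapReflection (e x : Sphere d) : sphereMap (swapReflection e x) e = x :=
  Subtype.ext (Submodule.reflection_sub (by simp))

theorem measurable_swapReflection (e : Sphere d) :
    Measurable fun q : Sphere d × E d => swapReflection e q.1 q.2 := by
  simp only [swapReflection, Submodule.reflection_orthogonal_apply,
    Submodule.reflection_singleton_apply, RCLike.ofReal_real_eq_id, id_eq]
  fun_prop

/-- The measure `μ_x` depends measurably on `x`: it is the image of one fixed `μ_e` under the
reflection that takes `e` to `x`, and this reflection depends measurably on `x`. -/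
theorem measurable_tangentMeasureE : Measurable (tangentMeasureE (d := d)) := by
  rcases isEmpty_or_nonempty (Sphere d) with h | ⟨⟨e⟩⟩
  · exact measurable_of_empty _
  refine Measure.measurable_of_measurable_coe _ fun A hA => ?_
  have h : ∀ x : Sphere d, tangentMeasureE x A =
      ∫⁻ w, A.indicator 1 (swapReflection e x w) ∂tangentMeasureE e := by
    intro x
    have hx := map_tangentMeasureE (swapReflection e x) e
    rw [sphereMap_swapReflection] at hx
    rw [← hx, Measure.map_apply (by fun_prop) hA, ← lintegral_indicator_one
      ((swapReflection e x).continuous.measurable hA)]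
    rfl
  simp only [h]
  exact Measurable.lintegral_prod_right'
    (f := fun q : Sphere d × E d => A.indicator 1 (swapReflection e q.1 q.2))
    ((measurable_one.indicator hA).comp (measurable_swapReflection e))

/-- The volume measures of the great subspheres, as a kernel from the sphere to `ℝ^d`. -/
def tangentKernel (d : ℕ) : Kernel (Sphere d) (E d) :=
  ⟨tangentMeasureE, measurable_tangentMeasureE⟩

instance : IsFiniteKernel (tangentKernel d) := by
  rcases isEmpty_or_nonempty (Sphere d) with h | ⟨⟨e⟩⟩
  · exact ⟨0, ENNReal.zero_lt_top, fun x => (h.false x).elim⟩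
  · refine ⟨tangentMeasureE e univ, measure_lt_top _ _, fun x => ?_⟩
    have hx := map_tangentMeasureE (swapReflection e x) e
    rw [sphereMap_swapReflection] at hx
    show tangentMeasureE x univ ≤ _
    rw [← hx, Measure.map_apply (by fun_prop) MeasurableSet.univ, preimage_univ]

/-- The Liouville measure on the unit tangent bundle of the sphere, as a measure on
`ℝ^d × ℝ^d`: a base point is distributed according to the surface measure, and a direction according
to the volume measure of the great subsphere with this pole. -/
def liouville (d : ℕ) : Measure (E d × E d) :=
  ((sphereMeasure d) ⊗ₘ (tangentKernel d)).map fun q => ((q.1 : E d), q.2)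

instance : IsFiniteMeasure (liouville d) := by
  unfold liouville
  infer_instance

theorem lintegral_liouville {F : E d × E d → ℝ≥0∞} (hF : Measurable F) :
    ∫⁻ q, F q ∂liouville d = ∫⁻ x, ∫⁻ w, F (x, w) ∂tangentMeasureE x ∂sphereMeasure d := by
  rw [liouville, lintegral_map hF (by fun_prop), Measure.lintegral_compProd (by fun_prop)]
  rfl

theorem lintegral_tangentMeasureE (x : Sphere d) {f : E d → ℝ≥0∞} (hf : Measurable f) :
    ∫⁻ w, f w ∂tangentMeasureE x = ∫⁻ v : TangentSphere x, f (v : TangentSpaceAt x)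
      ∂tangentMeasure x :=
  lintegral_map hf (measurable_coe_coe x)

/-- Orthonormal pairs of vectors, i.e. unit tangent vectors of the sphere. -/
def IsOrthonormalPair (q : E d × E d) : Prop := ‖q.1‖ = 1 ∧ ‖q.2‖ = 1 ∧ inner ℝ q.1 q.2 = 0

theorem isOrthonormalPair_coe (x : Sphere d) (v : TangentSphere x) :
    IsOrthonormalPair ((x : E d), ((v : TangentSpaceAt x) : E d)) :=
  ⟨by simp, norm_eq_of_mem_sphere v,
    Submodule.mem_orthogonal_singleton_iff_inner_right.1 (v : TangentSpaceAt x).2⟩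

theorem ae_liouville_isOrthonormalPair : ∀ᵐ q ∂liouville d, IsOrthonormalPair q := by
  have hm : MeasurableSet {q : E d × E d | IsOrthonormalPair q} := by
    refine (measurableSet_eq_fun (by fun_prop) (by fun_prop)).inter
      ((measurableSet_eq_fun (by fun_prop) (by fun_prop)).inter
        (measurableSet_eq_fun (by fun_prop) (by fun_prop)))
  rw [liouville, ae_map_iff (by fun_prop) hm]
  refine Measure.ae_compProd_of_ae_ae ?_ (Filter.Eventually.of_forall fun x => ?_)
  · exact (by fun_prop : Measurable fun q : Sphere d × E d => ((q.1 : E d), q.2)) hm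
  · show ∀ᵐ w ∂tangentMeasureE x, ((x : E d), w) ∈ {q | IsOrthonormalPair q}
    rw [tangentMeasureE, ae_map_iff (measurable_coe_coe x).aemeasurable
      ((by fun_prop : Measurable fun w : E d => ((x : E d), w)) hm)]
    exact Filter.Eventually.of_forall fun v => isOrthonormalPair_coe x v

/-- Two reflections carry any orthonormal pair to any other. -/
theorem exists_isometry_of_isOrthonormalPair {q r : E d × E d} (hq : IsOrthonormalPair q)
    (hr : IsOrthonormalPair r) : ∃ g : E d ≃ₗᵢ[ℝ] E d, (g q.1, g q.2) = r := by
  obtain ⟨hq1, hq2, hq3⟩ := hq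
  obtain ⟨hr1, hr2, hr3⟩ := hr
  set g₁ := (ℝ ∙ (q.1 - r.1))ᗮ.reflection
  have h1 : g₁ q.1 = r.1 := Submodule.reflection_sub (hq1.trans hr1.symm)
  set g₂ := (ℝ ∙ (g₁ q.2 - r.2))ᗮ.reflection
  have h2 : g₂ (g₁ q.2) = r.2 := Submodule.reflection_sub (by rw [g₁.norm_map, hq2, hr2])
  have h3 : inner ℝ (g₁ q.2 - r.2) r.1 = 0 := by
    rw [inner_sub_left, ← h1, g₁.inner_map_map, real_inner_comm, hq3, h1, real_inner_comm, hr3,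
      sub_zero]
  have h4 : g₂ r.1 = r.1 := Submodule.reflection_mem_subspace_eq_self
    (Submodule.mem_orthogonal_singleton_iff_inner_right.2 h3)
  exact ⟨g₁.trans g₂, Prod.ext (by simp [h1, h4]) (by simp [h2])⟩

theorem lintegral_liouville_isometry {F : E d × E d → ℝ≥0∞} (hF : Measurable F)
    (g : E d ≃ₗᵢ[ℝ] E d) :
    ∫⁻ q, F (g q.1, g q.2) ∂liouville d = ∫⁻ q, F q ∂liouville d := by
  rw [lintegral_liouville hF,
    lintegral_liouville (F := fun q => F (g q.1, g q.2)) (by fun_prop)]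
  have hk : Measurable fun x : Sphere d => ∫⁻ w, F (x, w) ∂tangentMeasureE x :=
    Measurable.lintegral_kernel_prod_right' (κ := tangentKernel d)
      (f := fun q : Sphere d × E d => F (q.1, q.2)) (by fun_prop)
  conv_rhs => rw [← map_sphereMeasure g, lintegral_map hk (measurable_sphereMap g)]
  refine lintegral_congr fun x => ?_
  rw [← map_tangentMeasureE, lintegral_map (by fun_prop) (by fun_prop)]
  rfl

/-! ### Invariance of the Liouville measure under the geodesic flow -/

instance : ContinuousStar (E d →L[ℝ] E d) :=
  ⟨(ContinuousLinearMap.adjoint (𝕜 := ℝ) (E := E d) (F := E d)).continuous⟩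

instance : CompactSpace (unitary (E d →L[ℝ] E d)) := by
  refine isCompact_iff_compactSpace.1 <| Metric.isCompact_of_isClosed_isBounded isClosed_unitary
    ((Metric.isBounded_closedBall (x := 0) (r := 1)).subset fun u hu => ?_)
  rw [mem_closedBall_zero_iff]
  exact ContinuousLinearMap.opNorm_le_bound _ zero_le_one fun x => by
    rw [ContinuousLinearMap.norm_map_of_mem_unitary hu, one_mul]

/-- If a measure `μ` is invariant under the action of a group with an invariant probability measure,
and the action is transitive on a conull set, then `μ` is invariant under every map `T` of this set
that commutes with the action: the average of an integrand over the group has the same integral and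
is constant on the conull set. -/
theorem lintegral_comp_of_transitive {G X : Type*} [Group G] [MeasurableSpace G] [MeasurableMul G]
    [MeasurableInv G] (ν : Measure G) [IsProbabilityMeasure ν] [ν.IsMulLeftInvariant]
    [MeasurableSpace X] {μ : Measure X} [SFinite μ] {act : G → X → X}
    (hact : Measurable (Function.uncurry act)) (hmul : ∀ g h x, act (g * h) x = act g (act h x))
    (hinv : ∀ g {f : X → ℝ≥0∞}, Measurable f → ∫⁻ x, f (act g x) ∂μ = ∫⁻ x, f x ∂μ)
    {P : X → Prop} (hP : ∀ᵐ x ∂μ, P x) (htrans : ∀ x y, P x → P y → ∃ g, act g x = y)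
    {T : X → X} (hT : Measurable T) (hTP : ∀ x, P x → P (T x))
    (hTact : ∀ g x, T (act g x) = act g (T x)) {F : X → ℝ≥0∞} (hF : Measurable F) :
    ∫⁻ x, F (T x) ∂μ = ∫⁻ x, F x ∂μ := by
  have havg : ∀ {f : X → ℝ≥0∞}, Measurable f →
      ∫⁻ x, ∫⁻ g, f (act g⁻¹ x) ∂ν ∂μ = ∫⁻ x, f x ∂μ := by
    intro f hf
    have hfm : Measurable (Function.uncurry fun (x : X) (g : G) => f (act g⁻¹ x)) :=
      hf.comp (hact.comp (measurable_snd.inv.prodMk measurable_fst))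
    rw [lintegral_lintegral_swap hfm.aemeasurable]
    simp [hinv _ hf]
  have hFT : Measurable fun x => F (T x) := hF.comp hT
  rw [← havg hF, ← havg hFT]
  refine lintegral_congr_ae ?_
  filter_upwards [hP] with x hx
  obtain ⟨h, hh⟩ := htrans x (T x) hx (hTP x hx)
  rw [← lintegral_mul_left_eq_self (μ := ν) (fun g => F (act g⁻¹ x)) h⁻¹]
  refine lintegral_congr fun g => ?_
  rw [hTact, mul_inv_rev, inv_inv, hmul, hh]

/-- Every measurable map of orthonormal pairs that commutes with the orthogonal group preserves the
Liouville measure. -/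
theorem lintegral_liouville_of_equivariant {F : E d × E d → ℝ≥0∞} (hF : Measurable F)
    {T : E d × E d → E d × E d} (hT : Measurable T)
    (hTo : ∀ q, IsOrthonormalPair q → IsOrthonormalPair (T q))
    (hTg : ∀ (g : E d ≃ₗᵢ[ℝ] E d) q, T (g q.1, g q.2) = (g (T q).1, g (T q).2)) :
    ∫⁻ q, F (T q) ∂liouville d = ∫⁻ q, F q ∂liouville d := by
  have : IsProbabilityMeasure (Measure.haarMeasure (⊤ :
      TopologicalSpace.PositiveCompacts (unitary (E d →L[ℝ] E d)))) :=
    ⟨Measure.haarMeasure_self⟩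
  refine lintegral_comp_of_transitive (Measure.haarMeasure (⊤ :
      TopologicalSpace.PositiveCompacts (unitary (E d →L[ℝ] E d)))) (μ := liouville d)
    (act := fun g q => (Unitary.linearIsometryEquiv g q.1, Unitary.linearIsometryEquiv g q.2))
    ?_ (fun g h q => ?_) (fun g f hf => lintegral_liouville_isometry hf _)
    ae_liouville_isOrthonormalPair (fun q r hq hr => ?_) hT hTo (fun g q => hTg _ q) hF
  · have hc : Continuous fun z : unitary (E d →L[ℝ] E d) × (E d × E d) =>
        ((z.1 : E d →L[ℝ] E d) z.2.1, (z.1 : E d →L[ℝ] E d) z.2.2) :=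
      ((continuous_subtype_val.comp continuous_fst).clm_apply
        (continuous_fst.comp continuous_snd)).prodMk
      ((continuous_subtype_val.comp continuous_fst).clm_apply
        (continuous_snd.comp continuous_snd))
    exact hc.measurable
  · rw [map_mul]
    rfl
  · obtain ⟨g, hg⟩ := exists_isometry_of_isOrthonormalPair hq hr
    obtain ⟨u, rfl⟩ := Unitary.linearIsometryEquiv.surjective g
    exact ⟨u, hg⟩

/-- The geodesic flow `(x, v) ↦ (γ(s), γ'(s))`, as a map of pairs of vectors. -/
def geodesicFlow (s : ℝ) (q : E d × E d) : E d × E d :=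
  (Real.cos s • q.1 + Real.sin s • q.2, -Real.sin s • q.1 + Real.cos s • q.2)

/-- Liouville's theorem for the geodesic flow of the sphere. -/
theorem lintegral_liouville_geodesicFlow {F : E d × E d → ℝ≥0∞} (hF : Measurable F) (s : ℝ) :
    ∫⁻ q, F (geodesicFlow s q) ∂liouville d = ∫⁻ q, F q ∂liouville d := by
  refine lintegral_liouville_of_equivariant hF (by unfold geodesicFlow; fun_prop) ?_ fun g q => by
    simp [geodesicFlow]
  rintro ⟨x, w⟩ ⟨h1, h2, h3⟩
  simp only at h1 h2 h3
  have h3' : inner ℝ w x = 0 := by rw [real_inner_comm, h3]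
  have hsq := Real.sin_sq_add_cos_sq s
  refine ⟨?_, ?_, ?_⟩
  · rw [← sq_eq_sq₀ (norm_nonneg _) zero_le_one, ← real_inner_self_eq_norm_sq]
    simp only [geodesicFlow, inner_add_left, inner_add_right, inner_smul_left, inner_smul_right,
      real_inner_self_eq_norm_sq, h1, h2, h3, h3', RCLike.conj_to_real]
    linarith
  · rw [← sq_eq_sq₀ (norm_nonneg _) zero_le_one, ← real_inner_self_eq_norm_sq]
    simp only [geodesicFlow, inner_add_left, inner_add_right, inner_smul_left, inner_smul_right,
      real_inner_self_eq_norm_sq, h1, h2, h3, h3', RCLike.conj_to_real]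
    linarith
  · simp only [geodesicFlow, inner_add_left, inner_add_right, inner_smul_left, inner_smul_right,
      real_inner_self_eq_norm_sq, h1, h2, h3, h3', RCLike.conj_to_real]
    ring

end Sphere

/-! ### Reversibility on the level sets -/

section LevelSet

variable {d : ℕ}

/-- The parameters `θ` for which the circle `cos(θ) x + sin(θ) w` is in `A`. -/
def circlePreimage (A : Set (E d)) (q : E d × E d) : Set ℝ :=
  {θ | Real.cos θ • q.1 + Real.sin θ • q.2 ∈ A}

theorem circlePreimage_periodic (A : Set (E d)) (q : E d × E d) (θ : ℝ) :
    θ + 2 * Real.pi ∈ circlePreimage A q ↔ θ ∈ circlePreimage A q := by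
  simp only [circlePreimage, mem_ofPred_eq, Real.cos_add_two_pi, Real.sin_add_two_pi]

theorem circlePreimage_geodesicFlow (A : Set (E d)) (q : E d × E d) (s : ℝ) :
    circlePreimage A (geodesicFlow s q) = translate (circlePreimage A q) s := by
  ext θ
  have : Real.cos θ • (Real.cos s • q.1 + Real.sin s • q.2) +
      Real.sin θ • (-Real.sin s • q.1 + Real.cos s • q.2) =
      Real.cos (s + θ) • q.1 + Real.sin (s + θ) • q.2 := by
    rw [Real.cos_add, Real.sin_add]
    module
  simp only [circlePreimage, geodesicFlow, translate, mem_preimage, mem_ofPred_eq, this]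

theorem measurableSet_circlePreimage {β : Type*} [MeasurableSpace β] {A : β → Set (E d)}
    (hA : MeasurableSet {x : β × E d | x.2 ∈ A x.1}) {q : β → E d × E d} (hq : Measurable q) :
    MeasurableSet {x : β × ℝ | x.2 ∈ circlePreimage (A x.1) (q x.1)} :=
  (by fun_prop : Measurable fun x : β × ℝ =>
    (x.1, Real.cos x.2 • (q x.1).1 + Real.sin x.2 • (q x.1).2)) hA

/-- The probability that the shrinkage procedure on the circle through `q`, with acceptance set `L`,
returns a point of `A`. -/
def shrinkProb (L A : Set (E d)) (q : E d × E d) : ℝ≥0∞ :=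
  ∑' n, circleProb (circlePreimage L q) (circlePreimage A q) n

theorem measurable_shrinkProb {β : Type*} [MeasurableSpace β] {L : β → Set (E d)}
    (hL : MeasurableSet {x : β × E d | x.2 ∈ L x.1}) {A : Set (E d)} (hA : MeasurableSet A)
    {q : β → E d × E d} (hq : Measurable q) :
    Measurable fun b => shrinkProb (L b) A (q b) := by
  unfold shrinkProb
  exact Measurable.tsum fun n => measurable_circleProb
    (S := fun b => circlePreimage (L b) (q b)) (R := fun b => circlePreimage A (q b))
    (measurableSet_circlePreimage hL hq)
    (measurableSet_circlePreimage (A := fun _ => A) (measurable_snd hA) hq) n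

theorem lintegral_shrinkProb_geodesicFlow {L A B : Set (E d)} (hL : MeasurableSet L)
    (hA : MeasurableSet A) (hB : MeasurableSet B) (q : E d × E d) :
    ∫⁻ s in Ioc 0 (2 * Real.pi), (L ∩ B).indicator
        (fun _ => shrinkProb L A (geodesicFlow s q)) (geodesicFlow s q).1 =
      ∫⁻ s in Ioc 0 (2 * Real.pi), (L ∩ A).indicator
        (fun _ => shrinkProb L B (geodesicFlow s q)) (geodesicFlow s q).1 := by
  have hm : ∀ {A : Set (E d)}, MeasurableSet A → MeasurableSet (circlePreimage A q) :=
    fun hA => (by fun_prop : Measurable fun θ : ℝ => Real.cos θ • q.1 + Real.sin θ • q.2) hA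
  have key : ∀ {A B : Set (E d)}, MeasurableSet A → MeasurableSet B →
      ∫⁻ s in Ioc 0 (2 * Real.pi), (L ∩ B).indicator
        (fun _ => shrinkProb L A (geodesicFlow s q)) (geodesicFlow s q).1 =
      ∑' n, ∫⁻ s in Ioc 0 (2 * Real.pi), (circlePreimage L q ∩ circlePreimage B q).indicator
        (fun s => circleProb (translate (circlePreimage L q) s) (translate (circlePreimage A q) s)
          n) s := by
    intro A B hA hB
    rw [← lintegral_tsum]
    · refine lintegral_congr fun s => ?_
      by_cases h : s ∈ circlePreimage L q ∩ circlePreimage B q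
      · rw [indicator_of_mem (show (geodesicFlow s q).1 ∈ L ∩ B from h)]
        simp only [indicator_of_mem h, shrinkProb, circlePreimage_geodesicFlow]
      · rw [indicator_of_notMem (show (geodesicFlow s q).1 ∉ L ∩ B from h)]
        simp only [indicator_of_notMem h, tsum_zero]
    · intro n
      have h : Measurable fun s => circleProb (translate (circlePreimage L q) s)
          (translate (circlePreimage A q) s) n :=
        measurable_circleProb (S := fun s => translate (circlePreimage L q) s)
          (R := fun s => translate (circlePreimage A q) s)
          (measurableSet_translate (hm hL) (s := fun s => s) measurable_id)
          (measurableSet_translate (hm hA) (s := fun s => s) measurable_id) n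
      exact (h.indicator ((hm hL).inter (hm hB))).aemeasurable
  rw [key hA hB, key hB hA]
  exact tsum_congr fun n => circleProb_reversible (hm hL) (hm hB) (hm hA)
    (circlePreimage_periodic L q) (circlePreimage_periodic B q) (circlePreimage_periodic A q) n

/-- The geodesic shrinkage step with acceptance set `L` is reversible with respect to the surface
measure on `L`. By the invariance of the Liouville measure the start may be averaged along its
great circle, where the step is reversible. -/
theorem lintegral_liouville_shrinkProb {L A B : Set (E d)} (hL : MeasurableSet L)
    (hA : MeasurableSet A) (hB : MeasurableSet B) :
    ∫⁻ q, (L ∩ B).indicator (fun _ => shrinkProb L A q) q.1 ∂liouville d =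
      ∫⁻ q, (L ∩ A).indicator (fun _ => shrinkProb L B q) q.1 ∂liouville d := by
  have key : ∀ {A B : Set (E d)}, MeasurableSet A → MeasurableSet B →
      ENNReal.ofReal (2 * Real.pi) *
        ∫⁻ q, (L ∩ B).indicator (fun _ => shrinkProb L A q) q.1 ∂liouville d =
      ∫⁻ q, ∫⁻ s : ℝ in Ioc 0 (2 * Real.pi), (L ∩ B).indicator
        (fun _ => shrinkProb L A (geodesicFlow s q)) (geodesicFlow s q).1 ∂volume ∂liouville d := by
    intro A B hA hB
    have hF : Measurable fun q : E d × E d =>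
        (L ∩ B).indicator (fun _ => shrinkProb L A q) q.1 :=
      measurable_indicator_family (S := fun _ => L ∩ B) (measurable_snd (hL.inter hB))
        (measurable_shrinkProb (L := fun _ => L) (measurable_snd hL) hA measurable_id)
        measurable_fst
    have hflow : Measurable fun z : (E d × E d) × ℝ => geodesicFlow z.2 z.1 := by
      unfold geodesicFlow
      fun_prop
    have hFm : Measurable (Function.uncurry fun (q : E d × E d) (s : ℝ) => (L ∩ B).indicator
        (fun _ => shrinkProb L A (geodesicFlow s q)) (geodesicFlow s q).1) := hF.comp hflow
    rw [lintegral_lintegral_swap hFm.aemeasurable]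
    simp only [lintegral_liouville_geodesicFlow hF]
    rw [setLIntegral_const, Real.volume_Ioc, sub_zero, mul_comm]
  have h := key hA hB
  simp only [lintegral_shrinkProb_geodesicFlow hL hA hB] at h
  rw [← key hB hA] at h
  exact (ENNReal.mul_right_inj (by simpa using Real.pi_pos) ENNReal.ofReal_ne_top).1 h

end LevelSet

/-! ### The transition kernel -/

section Sampler

variable {d : ℕ} {p : Sphere d → ℝ}

theorem continuous_geodesic (x : Sphere d) (v : TangentSphere x) : Continuous (geodesic x v) :=
  Continuous.subtype_mk (by fun_prop) _

theorem geodesic_add_two_pi (x : Sphere d) (v : TangentSphere x) (θ : ℝ) :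
    geodesic x v (θ + 2 * Real.pi) = geodesic x v θ := by
  simp only [geodesic, Real.cos_add_two_pi, Real.sin_add_two_pi]

theorem geodesic_toIcoMod (x : Sphere d) (v : TangentSphere x) (θ : ℝ) :
    geodesic x v (toIcoMod Real.two_pi_pos 0 θ) = geodesic x v θ := by
  simp only [geodesic, toIcoMod, zsmul_eq_mul, Real.cos_sub_int_mul_two_pi,
    Real.sin_sub_int_mul_two_pi]

theorem measurable_shrinkOutput (hp : Measurable p) (x : Sphere d) (v : TangentSphere x) (t : ℝ) :
    Measurable (shrinkOutput p x v t) := by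
  have hS : MeasurableSet {θ | t < p (geodesic x v θ)} :=
    measurableSet_lt measurable_const (hp.comp (continuous_geodesic x v).measurable)
  have hacc : ∀ n, MeasurableSet {u | n ∈ shrinkAccepts p x v t u} :=
    fun n => measurable_shrinkState_θ n hS
  have hN : Measurable fun u => sInf (shrinkAccepts p x v t u) := by
    refine measurable_to_countable' fun n => ?_
    -- The second set accounts for the convention `sInf ∅ = 0`.
    have : (fun u => sInf (shrinkAccepts p x v t u)) ⁻¹' {n} =
        ({u | n ∈ shrinkAccepts p x v t u} ∩ ⋂ m, ⋂ (_ : m < n),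
          {u | m ∈ shrinkAccepts p x v t u}ᶜ) ∪
        {u | n = 0} ∩ ⋂ m, {u | m ∈ shrinkAccepts p x v t u}ᶜ := by
      ext u
      simp only [mem_preimage, mem_singleton_iff, mem_union, mem_inter_iff, mem_ofPred_eq,
        mem_iInter, mem_compl_iff]
      constructor
      · rintro rfl
        rcases (shrinkAccepts p x v t u).eq_empty_or_nonempty with h | h
        · exact Or.inr (by simp [h])
        · exact Or.inl ⟨Nat.sInf_mem h, fun m hm => Nat.notMem_of_lt_sInf hm⟩
      · rintro (⟨h1, h2⟩ | ⟨rfl, h⟩)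
        · exact le_antisymm (Nat.sInf_le h1) (not_lt.1 fun h3 => h2 _ h3 (Nat.sInf_mem ⟨n, h1⟩))
        · rw [eq_empty_of_forall_notMem h, Nat.sInf_empty]
    rw [this]
    exact ((hacc n).inter (MeasurableSet.iInter fun m => MeasurableSet.iInter fun _ =>
      (hacc m).compl)).union ((MeasurableSet.const _).inter
        (MeasurableSet.iInter fun m => (hacc m).compl))
  have hθ : Measurable fun z : (ℕ → unitInterval) × ℕ => (shrinkState z.1 z.2).θ :=
    measurable_from_prod_countable_left fun n => measurable_shrinkState_θ n
  exact hθ.comp (measurable_id.prodMk hN)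

theorem measurable_toIcoMod_two_pi : Measurable (toIcoMod Real.two_pi_pos 0) := by
  simp only [funext (toIcoMod_eq_fract_mul Real.two_pi_pos)]
  fun_prop

/-- The law of the point of the sphere that is returned by the shrinkage procedure along the great
circle through `x` in the direction `v`. -/
def shrinkagePointDist (p : Sphere d → ℝ) (x : Sphere d) (v : TangentSphere x) (t : ℝ) :
    Measure (Sphere d) :=
  ((shrinkageDist p x v t).restrict (Ico 0 (2 * Real.pi))).map (geodesic x v)

theorem lintegral_shrinkageDist (x : Sphere d) (v : TangentSphere x) (t : ℝ) {A : Set (Sphere d)}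
    (hA : MeasurableSet A) :
    ∫⁻ θ in Ico 0 (2 * Real.pi), A.indicator 1 (geodesic x v θ) ∂(shrinkageDist p x v t) =
      shrinkagePointDist p x v t A := by
  rw [shrinkagePointDist, ← lintegral_indicator_one hA,
    lintegral_map (measurable_one.indicator hA) (continuous_geodesic x v).measurable]

theorem shrinkagePointDist_apply (hp : Measurable p) (x : Sphere d) (v : TangentSphere x) (t : ℝ)
    {A : Set (Sphere d)} (hA : MeasurableSet A) :
    shrinkagePointDist p x v t A =
      ∑' n, circleProb {θ | t < p (geodesic x v θ)} {θ | geodesic x v θ ∈ A} n := by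
  have hγ := (continuous_geodesic x v).measurable
  have hS : MeasurableSet {θ | t < p (geodesic x v θ)} :=
    measurableSet_lt measurable_const (hp.comp hγ)
  have hout : Measurable fun u => toIcoMod Real.two_pi_pos 0 (shrinkOutput p x v t u) :=
    measurable_toIcoMod_two_pi.comp (measurable_shrinkOutput hp x v t)
  set f : ℕ → Set (ℕ → unitInterval) := fun n =>
    {u | (∀ m < n, (shrinkState u m).θ ∉ {θ | t < p (geodesic x v θ)}) ∧
      (shrinkState u n).θ ∈ {θ | t < p (geodesic x v θ)} ∩ {θ | geodesic x v θ ∈ A}} with hf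
  have hfm : ∀ n, MeasurableSet (f n) := fun n => measurableSet_shrinkState_exit hS (hγ hA) n
  have hdisj : Pairwise (Function.onFun Disjoint f) := by
    intro m n hmn
    rw [Function.onFun, Set.disjoint_left]
    rintro u ⟨h1, h2⟩ ⟨h3, h4⟩
    rcases lt_or_gt_of_ne hmn with h | h
    · exact h3 m h h2.1
    · exact h1 n h h4.1
  have hset : (fun u => toIcoMod Real.two_pi_pos 0 (shrinkOutput p x v t u)) ⁻¹'
      (geodesic x v ⁻¹' A ∩ Ico 0 (2 * Real.pi)) ∩ {u | (shrinkAccepts p x v t u).Nonempty} =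
      ⋃ n, f n := by
    ext u
    have hI : toIcoMod Real.two_pi_pos 0 (shrinkOutput p x v t u) ∈ Ico 0 (2 * Real.pi) := by
      simpa using toIcoMod_mem_Ico Real.two_pi_pos 0 (shrinkOutput p x v t u)
    simp only [mem_inter_iff, mem_preimage, hI, and_true, geodesic_toIcoMod, mem_iUnion]
    constructor
    · rintro ⟨h1, h2⟩
      exact ⟨sInf (shrinkAccepts p x v t u), fun m hm => Nat.notMem_of_lt_sInf hm,
        Nat.sInf_mem h2, h1⟩
    · rintro ⟨n, h1, h2, h3⟩
      have hn : sInf (shrinkAccepts p x v t u) = n :=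
        le_antisymm (Nat.sInf_le h2) (not_lt.1 fun h => h1 _ h
          (show _ ∈ shrinkAccepts p x v t u from Nat.sInf_mem ⟨n, h2⟩))
      refine ⟨?_, n, h2⟩
      rw [shrinkOutput, hn]
      exact h3
  rw [shrinkagePointDist, Measure.map_apply hγ hA, Measure.restrict_apply (hγ hA), shrinkageDist,
    Measure.map_apply hout ((hγ hA).inter measurableSet_Ico),
    Measure.restrict_apply (hout ((hγ hA).inter measurableSet_Ico)), hset,
    measure_iUnion hdisj hfm]
  exact tsum_congr fun n => uniformSeq_shrinkState hS (hγ hA) n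

variable {P : E d → ℝ}

theorem shrinkagePointDist_eq_shrinkProb (hp : Measurable p) (hP : ∀ x : Sphere d, P x = p x)
    (x : Sphere d) (v : TangentSphere x) (t : ℝ) {A : Set (Sphere d)} (hA : MeasurableSet A) :
    shrinkagePointDist p x v t A =
      shrinkProb {y | t < P y} (Subtype.val '' A) ((x : E d), ((v : TangentSpaceAt x) : E d)) := by
  rw [shrinkagePointDist_apply hp x v t hA, shrinkProb]
  have h1 : {θ | t < p (geodesic x v θ)} =
      circlePreimage {y | t < P y} ((x : E d), ((v : TangentSpaceAt x) : E d)) := by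
    ext θ
    simp only [mem_ofPred_eq, ← hP]
    rfl
  have h2 : {θ | geodesic x v θ ∈ A} =
      circlePreimage (Subtype.val '' A) ((x : E d), ((v : TangentSpaceAt x) : E d)) := by
    ext θ
    exact (Subtype.val_injective.mem_set_image (s := A) (a := geodesic x v θ)).symm
  rw [h1, h2]

theorem measurableSet_coe_image {A : Set (Sphere d)} (hA : MeasurableSet A) :
    MeasurableSet (Subtype.val '' A : Set (E d)) :=
  Metric.isClosed_sphere.measurableSet.subtype_image hA

theorem measurableSet_superlevel (hPm : Measurable P) :
    MeasurableSet {z : ℝ × E d | z.1 < P z.2} :=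
  measurableSet_lt measurable_fst (hPm.comp measurable_snd)

theorem measurable_shrinkagePointDist (hp : Measurable p) (hPm : Measurable P)
    (hP : ∀ x : Sphere d, P x = p x) (x : Sphere d) (t : ℝ) {A : Set (Sphere d)}
    (hA : MeasurableSet A) : Measurable fun v => shrinkagePointDist p x v t A := by
  simp only [shrinkagePointDist_eq_shrinkProb hp hP x _ t hA]
  have hL : MeasurableSet {y | t < P y} := measurableSet_lt measurable_const hPm
  exact measurable_shrinkProb (L := fun _ => {y | t < P y}) (measurable_snd hL)
    (measurableSet_coe_image hA) (measurable_const.prodMk (measurable_coe_coe x))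

theorem levelKernel_eq (hp : Measurable p) (hPm : Measurable P) (hP : ∀ x : Sphere d, P x = p x)
    (t : ℝ) (x : Sphere d) {A : Set (Sphere d)} (hA : MeasurableSet A) :
    levelKernel p t x A = (sphereArea (d - 1))⁻¹ *
      ∫⁻ w, shrinkProb {y | t < P y} (Subtype.val '' A) ((x : E d), w) ∂tangentMeasureE x := by
  have hL : MeasurableSet {y | t < P y} := measurableSet_lt measurable_const hPm
  rw [lintegral_tangentMeasureE x (measurable_shrinkProb (L := fun _ => {y | t < P y})
    (measurable_snd hL) (measurableSet_coe_image hA) (by fun_prop))]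
  simp only [levelKernel, lintegral_shrinkageDist x _ t hA,
    shrinkagePointDist_eq_shrinkProb hp hP x _ t hA]

theorem measurable_levelKernel (hp : Measurable p) (hPm : Measurable P)
    (hP : ∀ x : Sphere d, P x = p x) {A : Set (Sphere d)} (hA : MeasurableSet A) :
    Measurable fun z : Sphere d × ℝ => levelKernel p z.2 z.1 A := by
  simp only [levelKernel_eq hp hPm hP _ _ hA]
  refine Measurable.const_mul ?_ _
  have h : Measurable fun z : (Sphere d × ℝ) × E d =>
      shrinkProb {y | z.1.2 < P y} (Subtype.val '' A) ((z.1.1 : E d), z.2) :=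
    measurable_shrinkProb (L := fun z : (Sphere d × ℝ) × E d => {y | z.1.2 < P y})
      ((by fun_prop : Measurable fun z : ((Sphere d × ℝ) × E d) × E d => (z.1.1.2, z.2))
        (measurableSet_superlevel hPm)) (measurableSet_coe_image hA) (by fun_prop)
  exact Measurable.lintegral_kernel_prod_right' (κ := (tangentKernel d).prodMkRight ℝ) h

theorem measurable_levelKernel_left (hp : Measurable p) (hPm : Measurable P)
    (hP : ∀ x : Sphere d, P x = p x) (x : Sphere d) {A : Set (Sphere d)} (hA : MeasurableSet A) :
    Measurable fun t => levelKernel p t x A := by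
  have h1 := measurable_levelKernel hp hPm hP hA
  have h2 : Measurable fun t : ℝ => (x, t) := measurable_prodMk_left
  have h3 := h1.comp h2
  exact h3

theorem shrinkageSliceSampler_iUnion (hp : Measurable p) (hPm : Measurable P)
    (hP : ∀ x : Sphere d, P x = p x) (x : Sphere d) {f : ℕ → Set (Sphere d)}
    (hf : ∀ n, MeasurableSet (f n)) (hdisj : Pairwise (Function.onFun Disjoint f)) :
    shrinkageSliceSampler p x (⋃ n, f n) = ∑' n, shrinkageSliceSampler p x (f n) := by
  have h : ∀ t, levelKernel p t x (⋃ n, f n) = ∑' n, levelKernel p t x (f n) := by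
    intro t
    simp only [levelKernel, lintegral_shrinkageDist x _ t (MeasurableSet.iUnion hf),
      measure_iUnion hdisj hf, lintegral_shrinkageDist x _ t (hf _)]
    rw [ENNReal.tsum_mul_left, lintegral_tsum fun n =>
      (measurable_shrinkagePointDist hp hPm hP x t (hf n)).aemeasurable]
  simp only [shrinkageSliceSampler, h]
  rw [ENNReal.tsum_mul_left, lintegral_tsum fun n =>
    (measurable_levelKernel_left hp hPm hP x (hf n)).aemeasurable]

theorem setLIntegral_Ioo_zero (x : Sphere d) (f : ℝ → ℝ≥0∞) :
    ∫⁻ t in Ioo 0 (p x), f t = ∫⁻ t in Ioi 0, {y | t < p y}.indicator (fun _ => f t) x := by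
  rw [← Ioi_inter_Iio, inter_comm, ← setLIntegral_indicator measurableSet_Iio]
  exact lintegral_congr fun t => indicator_eq_indicator_of_iff Iff.rfl fun _ => rfl

theorem measurable_shrinkageSliceSampler (hp : Measurable p) (hPm : Measurable P)
    (hP : ∀ x : Sphere d, P x = p x) {A : Set (Sphere d)} (hA : MeasurableSet A) :
    Measurable fun x => shrinkageSliceSampler p x A := by
  simp only [shrinkageSliceSampler, setLIntegral_Ioo_zero]
  refine hp.ennreal_ofReal.inv.mul (Measurable.lintegral_prod_right'
    (f := fun z : Sphere d × ℝ => {y | z.2 < p y}.indicator (fun _ => levelKernel p z.2 z.1 A) z.1)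
    ?_)
  have hS : MeasurableSet {z : (Sphere d × ℝ) × Sphere d | z.1.2 < p z.2} :=
    measurableSet_lt (by fun_prop) (by fun_prop)
  exact measurable_indicator_family (S := fun z : Sphere d × ℝ => {y | z.2 < p y}) hS
    (measurable_levelKernel hp hPm hP hA)
    measurable_fst

/-- The geodesic shrinkage slice sampling kernel. The function `P` is any measurable extension of
`p` to `ℝ^d`. -/
def sliceKernel (hp : Measurable p) (hPm : Measurable P) (hP : ∀ x : Sphere d, P x = p x) :
    Kernel (Sphere d) (Sphere d) where
  toFun x := Measure.ofMeasurable (fun A _ => shrinkageSliceSampler p x A)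
    (by simp [shrinkageSliceSampler, levelKernel])
    fun _ hf hdisj => shrinkageSliceSampler_iUnion hp hPm hP x hf hdisj
  measurable' := by
    refine Measure.measurable_of_measurable_coe _ fun A hA => ?_
    simp only [Measure.ofMeasurable_apply A hA]
    exact measurable_shrinkageSliceSampler hp hPm hP hA

theorem sliceKernel_apply (hp : Measurable p) (hPm : Measurable P)
    (hP : ∀ x : Sphere d, P x = p x) (x : Sphere d) {A : Set (Sphere d)} (hA : MeasurableSet A) :
    sliceKernel hp hPm hP x A = shrinkageSliceSampler p x A :=
  Measure.ofMeasurable_apply (m0 := by simp [shrinkageSliceSampler, levelKernel])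
    (mU := fun _ hf hdisj => shrinkageSliceSampler_iUnion hp hPm hP x hf hdisj) A hA

theorem levelKernel_univ (hd : 3 ≤ d) (hlsc : LowerSemicontinuous p) (x : Sphere d) {t : ℝ}
    (ht : t < p x) : levelKernel p t x univ = 1 := by
  have h1 : ∀ v : TangentSphere x, shrinkagePointDist p x v t univ = 1 := by
    intro v
    rw [shrinkagePointDist_apply hlsc.measurable x v t MeasurableSet.univ]
    have hopen : IsOpen {θ | t < p (geodesic x v θ)} :=
      (hlsc.isOpen_preimage t).preimage (continuous_geodesic x v)
    have h0 : (0 : ℝ) ∈ {θ | t < p (geodesic x v θ)} := by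
      simpa [geodesic] using ht
    obtain ⟨δ, hδ, hball⟩ := Metric.isOpen_iff.1 hopen 0 h0
    rw [Real.ball_eq_Ioo, zero_sub, zero_add] at hball
    exact tsum_circleProb hδ hopen.measurableSet hball fun θ => by
      simp only [mem_ofPred_eq, geodesic_add_two_pi]
  have : Nontrivial (E (d - 1)) :=
    Module.nontrivial_of_finrank_pos (R := ℝ) (by rw [finrank_euclideanSpace_fin]; omega)
  have hω : sphereArea (d - 1) ≠ 0 := by
    rw [sphereArea, sphereMeasure, Measure.measure_univ_ne_zero]
    exact Measure.toSphere_ne_zero _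
  simp only [levelKernel, lintegral_shrinkageDist x _ t MeasurableSet.univ, h1, lintegral_one,
    tangentMeasure_univ hd]
  exact ENNReal.inv_mul_cancel hω (measure_ne_top _ _)

theorem shrinkageSliceSampler_univ (hd : 3 ≤ d) (hpos : ∀ x, 0 < p x)
    (hlsc : LowerSemicontinuous p) (x : Sphere d) : shrinkageSliceSampler p x univ = 1 := by
  rw [shrinkageSliceSampler, setLIntegral_congr_fun measurableSet_Ioo
    (g := fun _ => 1) fun t ht => levelKernel_univ hd hlsc x ht.2, setLIntegral_one,
    Real.volume_Ioo, sub_zero]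
  exact ENNReal.inv_mul_cancel (by simpa using hpos x) ENNReal.ofReal_ne_top

/-- Disintegration of the flow of mass from `B` to `A` along the levels `t`. -/
theorem setLIntegral_sliceKernel (hp : Measurable p) (hPm : Measurable P)
    (hP : ∀ x : Sphere d, P x = p x) (hpos : ∀ x, 0 < p x) {A B : Set (Sphere d)}
    (hA : MeasurableSet A) (hB : MeasurableSet B) :
    ∫⁻ x in B, sliceKernel hp hPm hP x A ∂target p =
      (ENNReal.ofReal (∫ x, p x ∂(sphereMeasure d)))⁻¹ * ∫⁻ t in Ioi 0, (sphereArea (d - 1))⁻¹ *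
        ∫⁻ q, ({y | t < P y} ∩ (Subtype.val '' B)).indicator
          (fun _ => shrinkProb {y | t < P y} (Subtype.val '' A) q) q.1 ∂liouville d := by
  simp only [sliceKernel_apply hp hPm hP _ hA]
  have hsm := measurable_shrinkageSliceSampler hp hPm hP hA
  rw [target, Measure.restrict_smul, lintegral_smul_measure, smul_eq_mul]
  congr 1
  rw [setLIntegral_withDensity_eq_setLIntegral_mul _ hp.ennreal_ofReal hsm hB,
    ← lintegral_indicator hB]
  have h1 : ∀ x, B.indicator ((fun x => ENNReal.ofReal (p x)) *
      fun x => shrinkageSliceSampler p x A) x =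
      ∫⁻ t in Ioi 0, ({y | t < p y} ∩ B).indicator (fun _ => levelKernel p t x A) x := by
    intro x
    by_cases hx : x ∈ B
    · rw [indicator_of_mem hx, Pi.mul_apply, shrinkageSliceSampler, ← mul_assoc,
        ENNReal.mul_inv_cancel (by simpa using hpos x) ENNReal.ofReal_ne_top, one_mul,
        setLIntegral_Ioo_zero]
      exact lintegral_congr fun t => indicator_eq_indicator_of_iff (by simp [hx]) fun _ => rfl
    · simp [hx]
  simp only [h1]
  have hm : Measurable (Function.uncurry fun (x : Sphere d) (t : ℝ) =>
      ({y | t < p y} ∩ B).indicator (fun _ => levelKernel p t x A) x) :=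
    measurable_indicator_family (S := fun z : Sphere d × ℝ => {y | z.2 < p y} ∩ B)
      ((measurableSet_lt (by fun_prop) (by fun_prop)).inter (measurable_snd hB))
      (measurable_levelKernel hp hPm hP hA) measurable_fst
  rw [lintegral_lintegral_swap hm.aemeasurable]
  refine lintegral_congr fun t => ?_
  have hL : MeasurableSet {y | t < P y} := measurableSet_lt measurable_const hPm
  have hF : Measurable fun q : E d × E d => shrinkProb {y | t < P y} (Subtype.val '' A) q :=
    measurable_shrinkProb (L := fun _ => {y | t < P y}) (measurable_snd hL)
      (measurableSet_coe_image hA) measurable_id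
  have hF' : Measurable fun q : E d × E d => ({y | t < P y} ∩ (Subtype.val '' B)).indicator
      (fun _ => shrinkProb {y | t < P y} (Subtype.val '' A) q) q.1 :=
    measurable_indicator_family (S := fun _ => {y | t < P y} ∩ (Subtype.val '' B))
      (measurable_snd (hL.inter (measurableSet_coe_image hB))) hF measurable_fst
  have hk : Measurable fun x : Sphere d => ∫⁻ w, ({y | t < P y} ∩ (Subtype.val '' B)).indicator
      (fun _ => shrinkProb {y | t < P y} (Subtype.val '' A) ((x : E d), w)) x ∂tangentMeasureE x :=
    Measurable.lintegral_kernel_prod_right' (κ := tangentKernel d)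
      (f := fun q : Sphere d × E d => ({y | t < P y} ∩ (Subtype.val '' B)).indicator
        (fun _ => shrinkProb {y | t < P y} (Subtype.val '' A) ((q.1 : E d), q.2)) q.1)
      (hF'.comp (by fun_prop : Measurable fun q : Sphere d × E d => ((q.1 : E d), q.2)))
  rw [lintegral_liouville hF', ← lintegral_const_mul _ hk]
  refine lintegral_congr fun x => ?_
  have hmem : (x : E d) ∈ ({y | t < P y} ∩ (Subtype.val '' B) : Set (E d)) ↔
      x ∈ {y | t < p y} ∩ B := by
    rw [mem_inter_iff, mem_inter_iff, Subtype.val_injective.mem_set_image, mem_ofPred_eq,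
      mem_ofPred_eq, hP]
  by_cases hx : x ∈ {y | t < p y} ∩ B
  · rw [indicator_of_mem hx, levelKernel_eq hp hPm hP t x hA]
    simp only [indicator_of_mem (hmem.2 hx)]
  · rw [indicator_of_notMem hx]
    simp only [indicator_of_notMem (mt hmem.1 hx), lintegral_zero, mul_zero]

end Sampler

end GeoSlice

end

theorem mainTheorem4 (d : ℕ) (hd : 3 ≤ d) (p : GeoSlice.Sphere d → ℝ)
    (hpos : ∀ x, 0 < p x)
    (hint : MeasureTheory.Integrable p (GeoSlice.sphereMeasure d))
    (hlsc : LowerSemicontinuous p) :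
    ∃ κ : ProbabilityTheory.Kernel (GeoSlice.Sphere d) (GeoSlice.Sphere d),
      ProbabilityTheory.IsMarkovKernel κ ∧
      (∀ (x : GeoSlice.Sphere d) (A : Set (GeoSlice.Sphere d)), MeasurableSet A →
        κ x A = GeoSlice.shrinkageSliceSampler p x A) ∧
      κ.IsReversible (GeoSlice.target p) := by
  have hp : Measurable p := hlsc.measurable
  -- A measurable extension of `p` to `ℝ^d` lets all great subspheres be treated jointly.
  obtain ⟨P, hPm, hP⟩ := (MeasurableEmbedding.subtype_coe
    (Metric.isClosed_sphere (x := (0 : GeoSlice.E d))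
      (ε := 1)).measurableSet).exists_measurable_extend hp fun _ => ⟨0⟩
  have hP' : ∀ x : GeoSlice.Sphere d, P x = p x := fun x => congrFun hP x
  refine ⟨GeoSlice.sliceKernel hp hPm hP', ⟨fun x => ⟨?_⟩⟩,
    fun x A hA => GeoSlice.sliceKernel_apply hp hPm hP' x hA, fun A B hA hB => ?_⟩
  · rw [GeoSlice.sliceKernel_apply hp hPm hP' x MeasurableSet.univ,
      GeoSlice.shrinkageSliceSampler_univ hd hpos hlsc]
  · rw [GeoSlice.setLIntegral_sliceKernel hp hPm hP' hpos hB hA,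
      GeoSlice.setLIntegral_sliceKernel hp hPm hP' hpos hA hB]
    simp only [GeoSlice.lintegral_liouville_shrinkProb (measurableSet_lt measurable_const hPm)
      (GeoSlice.measurableSet_coe_image hA) (GeoSlice.measurableSet_coe_image hB)]
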